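/- **Setting.** Consider $x_{t+1}=A(\theta)x_t+B(\theta)u_t$ with $x_t\in\mathbb R^n$, $u_t\in\mathbb R^m$, $\theta\in\mathbb R^p$, input constraint set $\mathcal U=\{u: Eu\le \mathbf 1\}$ (componentwise), and stage cost $\ell(x,u)=\ell_x(x)+\ell_u(u)$, $\ell_x(x)=x^\top Qx$, $\ell_u(u)=u^\top Ru$, $Q,R\succ0$; put $\ell^\star(x)=\min_{u\in\mathcal U}\ell(x,u)$ $(=\ell_x(x))$. Let $\hat\theta$ be the nominal parameter, $\delta(\theta)=\|\theta-\hat\theta\|$, and $\Theta$ a set of parameters on which $\delta$ is bounded. All norms are Euclidean. Let $m_x,L_x,m_u,L_u>0$ and $L_{f,x},L_{f,u},L_\Delta\ge0$ be constants with $\frac{m_x}{2}\|x\|^2\le\ell_x(x)$, $\|\nabla\ell_x(x)\|\le L_x\|x\|$, $\frac{m_u}{2}\|u\|^2\le\ell_u(u)$, $\|\nabla\ell_u(u)\|\le L_u\|u\|$ for all $x,u$; $\|A(\hat\theta)x\|\le L_{f,x}\|x\|$, $\|B(\hat\theta)u\|\le L_{f,u}\|u\|$ for all $x,u$; and $\|(A(\theta)-A(\hat\theta))x\|\le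 L_\Delta\delta(\theta)\|x\|$, $\|(B(\theta)-B(\hat\theta))u\|\le L_\Delta\delta(\theta)\|u\|$ for all $\theta\in\Theta$ and all $x,u$. For $N\ge1$ let $V_N(x;\theta)$ be the minimum of $\sum_{k=0}^{N-1}\ell(x_k,u_k)+\ell^\star(x_N)$ over $u_0,\dots,u_{N-1}\in\mathcal U$, where $x_0=x$ and $x_{k+1}=A(\theta)x_k+B(\theta)u_k$. Let $u^\star_k(x;\theta)$ and $\xi^\star_k(x;\theta)$ be the optimal inputs and states and $\mu_{N,\theta}(x)=u_0^\star(x;\theta)$ the MPC policy. The certainty-equivalence MPC (CE-MPC) closed loop is $x_{t+1}=A(\theta)x_t+B(\theta)\mu_{N,\hat\theta}(x_t)$, $x_0=x$, with infinite-horizon cost $J_\infty(x;\mu_{N,\hat\theta},\theta)=\sum_{t\ge0}\ell(x_t,\mu_{N,\hat\theta}(x_t))\in[0,\infty]$. Let $V_\infty(x;\theta)\in[0,\infty]$ be the infimum of $\sum_{t\ge0}\ell(x_t,u_t)$ over all input sequences in $\mathcal U$ for the model $\theta$ (the oracle LQ cost). Let $\mathcal X\subseteq\mathbb R^n$, $\kappa\ge0$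 and $0<\gamma_i\le\bar\gamma$ $(i\ge1)$ be such that for all $x\in\mathcal X$: $\min_{u\in\mathcal U}\{\ell_x(A(\hat\theta)x+B(\hat\theta)u)+\ell(x,u)\}\le(1+\kappa)\ell_x(x)$, and $V_i(x;\hat\theta)\le(1+\gamma_i)\ell^\star(x)$ for all $i\ge1$. Fix $N\ge1$ and put $$\epsilon_N=\frac{\kappa\,\gamma_N\prod_{i=2}^N\gamma_i}{(1+\kappa)\prod_{i=2}^N(1+\gamma_i)-\kappa\prod_{i=2}^N\gamma_i}.$$ For $S\subseteq\mathbb R^n$, call $(C,\rho,\omega)$ with $C>0$, $\rho\in(0,1)$, $\omega\ge0$ *sensitivity constants on $S$* (for this $N$) if for $0\le k<N$ $$\|u_k^\star(x;\hat\theta)-u_k^\star(y;\hat\theta)\|\le C\rho^k\|x-y\|\ (x,y\in S),\qquad \|u_k^\star(x;\theta)-u_k^\star(x;\hat\theta)\|\le\omega\,\delta(\theta)\|x\|\ (x\in S,\ \theta\in\Theta).$$ Put $M=2(\frac1{m_x}+\frac1{m_u})$, $\Gamma_k=L_{f,x}^k+L_{f,u}C\sum_{i=0}^{k-1}L_{f,x}^{k-1-i}\rho^i$,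 $P=\sum_{k=1}^N L_{f,u}^2\big(\sum_{i=0}^{k-1}L_{f,x}^i\big)^2+\sum_{k=1}^N\sum_{i=0}^{k-1}L_{f,x}^{2i}$, and define the quadratic functions $$\alpha_N^*(\delta)=M\Big[\tfrac{L_x}2\sum_{k=0}^N\Gamma_k^2+\tfrac{L_uC^2}{2(1-\rho^2)}\Big]L_\Delta^2\,\delta^2+\Big[2M(\bar\gamma+\epsilon_N)\Big(\tfrac{L_x^2}{m_x}\sum_{k=0}^N\Gamma_k^2+\tfrac{L_u^2C^2}{m_u(1-\rho^2)}\Big)\Big]^{1/2}L_\Delta\,\delta,$$ $$\beta_N^*(\delta)=\Big[\tfrac{L_x}2\bar\gamma PM L_\Delta^2+\omega^2\Big(\tfrac{L_x}{m_x}P+\tfrac{L_u}{m_x}N\Big)\Big]\delta^2+\Big[\Big(\tfrac{2MP\bar\gamma}{m_x}\Big)^{1/2}L_xL_\Delta+2\omega\Big(\tfrac{L_x}{m_x}P^{1/2}+\tfrac{L_u}{\sqrt{m_xm_u}}N^{1/2}\Big)\Big]\delta .$$ **Claim.** 1. For all $\theta$ and $x$ the MPC problem has a solution, and its $N$ inputs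 are unique. 2. Sensitivity constants on $\mathbb R^n$ exist. 3. For all sensitivity constants $(C,\rho,\omega)$ on $\mathcal X$, let $$\mathcal R_N(\varepsilon)=\frac{1+\min\{\bar\gamma,\beta_N^*(\varepsilon)\}}{1-(\alpha_N^*(\varepsilon)+\epsilon_N)} .$$ Then $\mathcal R_N(0)=\frac1{1-\epsilon_N}$ (consistency; here $1/0:=0$ if $\epsilon_N=1$). Moreover, for every true parameter $\theta\in\Theta$ and every $\varepsilon\ge\delta(\theta)$ with $\alpha_N^*(\varepsilon)+\epsilon_N<1$: if the CE-MPC closed loop from $x$ and all the nominal predictions made along it (the states $\xi_k^\star(x_t;\hat\theta)$, $0\le k\le N$, $t\ge0$) lie in $\mathcal X$, then $$J_\infty(x;\mu_{N,\hat\theta},\theta)<\infty,\qquad J_\infty(x;\mu_{N,\hat\theta},\theta)\le \mathcal R_N(\varepsilon)\,V_\infty(x;\theta).$$ The requirement on the trajectories holds for every $x$ with $\{y:\ell_x(y)\le V_N(x;\hat\theta)\}\subseteq\mathcal X$ (in particular for every $x$ when $\mathcal X=\mathbb R^n$). -/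

import Mathlib

open Finset
open scoped ENNReal

noncomputable section

/-- An input-constrained linear system with parametric uncertainty `x⁺ = A(θ) x + B(θ) u`,
`x ∈ ℝⁿ`, `u ∈ ℝᵐ`, `θ ∈ ℝᵖ`, quadratic cost `ℓ(x,u) = xᵀ Q x + uᵀ R u` and
polytopic input constraint `E u ≤ 1` (componentwise, `r` inequalities). -/
structure LQSystem (n m p r : ℕ) where
  A : EuclideanSpace ℝ (Fin p) → Matrix (Fin n) (Fin n) ℝ
  B : EuclideanSpace ℝ (Fin p) → Matrix (Fin n) (Fin m) ℝ
  Q : Matrix (Fin n) (Fin n) ℝ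
  R : Matrix (Fin m) (Fin m) ℝ
  E : Matrix (Fin r) (Fin m) ℝ

namespace LQSystem

variable {n m p r : ℕ} (S : LQSystem n m p r)

/-- The dynamics `f(x, u; θ) = A(θ) x + B(θ) u`. -/
def step (θ : EuclideanSpace ℝ (Fin p)) (x : EuclideanSpace ℝ (Fin n))
    (u : EuclideanSpace ℝ (Fin m)) : EuclideanSpace ℝ (Fin n) :=
  Matrix.toEuclideanLin (S.A θ) x + Matrix.toEuclideanLin (S.B θ) u

/-- The state cost `ℓₓ(x) = xᵀ Q x`. -/
def costX (x : EuclideanSpace ℝ (Fin n)) : ℝ := inner ℝ x (Matrix.toEuclideanLin S.Q x)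

/-- The input cost `ℓᵤ(u) = uᵀ R u`. -/
def costU (u : EuclideanSpace ℝ (Fin m)) : ℝ := inner ℝ u (Matrix.toEuclideanLin S.R u)

/-- The stage cost `ℓ(x, u) = xᵀ Q x + uᵀ R u`. -/
def cost (x : EuclideanSpace ℝ (Fin n)) (u : EuclideanSpace ℝ (Fin m)) : ℝ :=
  S.costX x + S.costU u

/-- The input constraint set `𝒰 = {u | E u ≤ 1}`. -/
def inputSet : Set (EuclideanSpace ℝ (Fin m)) :=
  {u | ∀ i, Matrix.toEuclideanLin S.E u i ≤ 1}

/-- Input sequences all of whose entries satisfy the input constraint. -/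
def admissible : Set (ℕ → EuclideanSpace ℝ (Fin m)) := {u | ∀ k, u k ∈ S.inputSet}

/-- The optimal stage cost `ℓ⋆(x) = min_{u ∈ 𝒰} ℓ(x, u)`. -/
def costStar (x : EuclideanSpace ℝ (Fin n)) : ℝ := ⨅ u : S.inputSet, S.cost x u

/-- The open-loop state after `k` steps from `x` under the inputs `u` in the model `θ`. -/
def rollout (θ : EuclideanSpace ℝ (Fin p)) (x : EuclideanSpace ℝ (Fin n))
    (u : ℕ → EuclideanSpace ℝ (Fin m)) : ℕ → EuclideanSpace ℝ (Fin n)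
  | 0 => x
  | k + 1 => S.step θ (rollout θ x u k) (u k)

/-- The MPC objective `J_N(x; u, θ) = ∑_{k<N} ℓ(x_k, u_k) + ℓ⋆(x_N)`. It only depends on the
first `N` entries of `u`. -/
def mpcCost (N : ℕ) (θ : EuclideanSpace ℝ (Fin p)) (x : EuclideanSpace ℝ (Fin n))
    (u : ℕ → EuclideanSpace ℝ (Fin m)) : ℝ :=
  (∑ k ∈ range N, S.cost (S.rollout θ x u k) (u k)) + S.costStar (S.rollout θ x u N)

/-- The MPC value function `V_N(x; θ)`. -/
def mpcValue (N : ℕ) (θ : EuclideanSpace ℝ (Fin p)) (x : EuclideanSpace ℝ (Fin n)) : ℝ :=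
  ⨅ u : S.admissible, S.mpcCost N θ x u

/-- `u` solves the MPC problem with horizon `N`, model `θ` and initial state `x`. -/
def IsMPCSolution (N : ℕ) (θ : EuclideanSpace ℝ (Fin p)) (x : EuclideanSpace ℝ (Fin n))
    (u : ℕ → EuclideanSpace ℝ (Fin m)) : Prop :=
  u ∈ S.admissible ∧ ∀ v ∈ S.admissible, S.mpcCost N θ x u ≤ S.mpcCost N θ x v

open Classical in
/-- The MPC-optimal inputs `u⋆_k(x; θ)`, `k < N` (entries with `k ≥ N` are irrelevant). -/
def mpcInput (N : ℕ) (θ : EuclideanSpace ℝ (Fin p)) (x : EuclideanSpace ℝ (Fin n)) :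
    ℕ → EuclideanSpace ℝ (Fin m) :=
  if h : ∃ u, S.IsMPCSolution N θ x u then h.choose else 0

/-- The MPC policy `μ_{N,θ}(x) = u⋆_0(x; θ)`. -/
def policy (N : ℕ) (θ : EuclideanSpace ℝ (Fin p)) (x : EuclideanSpace ℝ (Fin n)) :
    EuclideanSpace ℝ (Fin m) := S.mpcInput N θ x 0

/-- The CE-MPC closed loop `x_{t+1} = f(x_t, μ_{N,θhat}(x_t); θ)`: the policy is designed for the
nominal parameter `θhat`, the state evolves with the true parameter `θ`. -/
def closedLoop (N : ℕ) (θhat θ : EuclideanSpace ℝ (Fin p)) (x : EuclideanSpace ℝ (Fin n)) :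
    ℕ → EuclideanSpace ℝ (Fin n)
  | 0 => x
  | t + 1 => S.step θ (closedLoop N θhat θ x t) (S.policy N θhat (closedLoop N θhat θ x t))

/-- The closed-loop infinite-horizon cost `J_∞(x; μ_{N,θhat}, θ) ∈ [0, ∞]`. -/
def closedLoopCost (N : ℕ) (θhat θ : EuclideanSpace ℝ (Fin p))
    (x : EuclideanSpace ℝ (Fin n)) : ℝ≥0∞ :=
  ∑' t, ENNReal.ofReal (S.cost (S.closedLoop N θhat θ x t)
    (S.policy N θhat (S.closedLoop N θhat θ x t)))

/-- The oracle infinite-horizon cost `V_∞(x; θ) ∈ [0, ∞]`: the infimum of the infinite-horizon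
cost over all admissible input sequences, in the model `θ`. -/
def oracleCost (θ : EuclideanSpace ℝ (Fin p)) (x : EuclideanSpace ℝ (Fin n)) : ℝ≥0∞ :=
  ⨅ u ∈ S.admissible, ∑' t, ENNReal.ofReal (S.cost (S.rollout θ x u t) (u t))

/-- The closed loop from `x`, and all nominal predictions made along it, remain in `X`. -/
def StaysIn (N : ℕ) (θhat θ : EuclideanSpace ℝ (Fin p)) (X : Set (EuclideanSpace ℝ (Fin n)))
    (x : EuclideanSpace ℝ (Fin n)) : Prop :=
  ∀ t, ∀ k ≤ N, S.rollout θhat (S.closedLoop N θhat θ x t)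
    (S.mpcInput N θhat (S.closedLoop N θhat θ x t)) k ∈ X

/-- Exponentially decaying sensitivity of the nominal MPC inputs to the initial state, on `X`. -/
def StateSensitivity (N : ℕ) (θhat : EuclideanSpace ℝ (Fin p))
    (X : Set (EuclideanSpace ℝ (Fin n))) (C ρ : ℝ) : Prop :=
  ∀ x ∈ X, ∀ y ∈ X, ∀ k < N,
    ‖S.mpcInput N θhat x k - S.mpcInput N θhat y k‖ ≤ C * ρ ^ k * ‖x - y‖

/-- Sensitivity of the MPC inputs to the parameter, on `X`, linear in the
mismatch `δ(θ) = ‖θ - θhat‖`. -/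
def ParamSensitivity (N : ℕ) (θhat : EuclideanSpace ℝ (Fin p))
    (Θ : Set (EuclideanSpace ℝ (Fin p))) (X : Set (EuclideanSpace ℝ (Fin n))) (ω : ℝ) : Prop :=
  ∀ θ ∈ Θ, ∀ x ∈ X, ∀ k < N,
    ‖S.mpcInput N θ x k - S.mpcInput N θhat x k‖ ≤ ω * ‖θ - θhat‖ * ‖x‖

end LQSystem

/-- The scalar constants of the problem. -/
structure LQConstants where
  /-- strong convexity modulus of the state cost -/
  mx : ℝ
  /-- smoothness constant of the state cost -/
  Lx : ℝ
  /-- strong convexity modulus of the input cost -/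
  mu : ℝ
  /-- smoothness constant of the input cost -/
  Lu : ℝ
  /-- Lipschitz constant of the nominal dynamics in the state -/
  Lfx : ℝ
  /-- Lipschitz constant of the nominal dynamics in the input -/
  Lfu : ℝ
  /-- Lipschitz constant of `A` and `B` at the nominal parameter -/
  LΔ : ℝ
  /-- relaxation constant of the control Lyapunov function -/
  κ : ℝ
  /-- cost controllability constants -/
  γ : ℕ → ℝ
  /-- uniform bound on the cost controllability constants -/
  γbar : ℝ

namespace LQConstants

variable (c : LQConstants)

/-- The nominal relaxation factor `ε_N`: without mismatch, the value function `V_N` decreases by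
at least `(1 - ε_N) ℓ` in each step. -/
def eps (N : ℕ) : ℝ :=
  c.κ * c.γ N * (∏ i ∈ Icc 2 N, c.γ i) /
    ((1 + c.κ) * (∏ i ∈ Icc 2 N, (1 + c.γ i)) - c.κ * ∏ i ∈ Icc 2 N, c.γ i)

/-- The error-matching constant. -/
def M : ℝ := 2 * (1 / c.mx + 1 / c.mu)

/-- Growth factor `Γ_k` of a perturbation of the initial state over `k` predicted steps. -/
def Γ (C ρ : ℝ) (k : ℕ) : ℝ :=
  c.Lfx ^ k + c.Lfu * C * ∑ i ∈ range k, c.Lfx ^ (k - 1 - i) * ρ ^ i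

/-- Second-order coefficient of the state perturbation bound. -/
def alpha2 (C ρ : ℝ) (N : ℕ) : ℝ :=
  c.M * (c.Lx / 2 * (∑ k ∈ range (N + 1), c.Γ C ρ k ^ 2) + c.Lu * C ^ 2 / (2 * (1 - ρ ^ 2)))

/-- First-order coefficient of the state perturbation bound. -/
def alpha1 (C ρ : ℝ) (N : ℕ) : ℝ :=
  √(2 * c.M * (c.γbar + c.eps N) * (c.Lx ^ 2 / c.mx * (∑ k ∈ range (N + 1), c.Γ C ρ k ^ 2) +
    c.Lu ^ 2 * C ^ 2 / (c.mu * (1 - ρ ^ 2))))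

/-- The state perturbation bound `α⋆_N(δ)`, a quadratic function of the mismatch `δ`. -/
def alphaStar (C ρ : ℝ) (N : ℕ) (δ : ℝ) : ℝ :=
  (c.alpha2 C ρ N * c.LΔ ^ 2) * δ ^ 2 + (c.alpha1 C ρ N * c.LΔ) * δ

/-- The constant `P` bounding accumulated squared state deviations. -/
def P (N : ℕ) : ℝ :=
  (∑ k ∈ Icc 1 N, c.Lfu ^ 2 * (∑ i ∈ range k, c.Lfx ^ i) ^ 2) +
    ∑ k ∈ Icc 1 N, ∑ i ∈ range k, c.Lfx ^ (2 * i)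

/-- Second-order coefficient of the parameter perturbation bound. -/
def beta2 (ω : ℝ) (N : ℕ) : ℝ :=
  c.Lx / 2 * c.γbar * c.P N * c.M * c.LΔ ^ 2 + ω ^ 2 * (c.Lx / c.mx * c.P N + c.Lu / c.mx * N)

/-- First-order coefficient of the parameter perturbation bound. -/
def beta1 (ω : ℝ) (N : ℕ) : ℝ :=
  √(2 * c.M * c.P N * c.γbar / c.mx) * c.Lx * c.LΔ +
    2 * ω * (c.Lx / c.mx * √(c.P N) + c.Lu / √(c.mx * c.mu) * √N)

/-- The parameter perturbation bound `β⋆_N(δ)`, a quadratic function of the mismatch `δ`. -/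
def betaStar (ω : ℝ) (N : ℕ) (δ : ℝ) : ℝ := c.beta2 ω N * δ ^ 2 + c.beta1 ω N * δ

/-- The competitive ratio `(1 + min{γbar, β⋆_N(δ)}) / (1 - (α⋆_N(δ) + ε_N))`. -/
def ratio (C ρ ω : ℝ) (N : ℕ) (δ : ℝ) : ℝ :=
  (1 + min c.γbar (c.betaStar ω N δ)) / (1 - (c.alphaStar C ρ N δ + c.eps N))

end LQConstants

end

/-! Since 0 is an admissible input and ℓ_u ≥ 0, the terminal cost ℓ⋆ equals ℓ_x. The MPC objective
J(x,u) is therefore a positive definite quadratic form in the state and the first N inputs,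
minimised over a convex set of inputs. Optimal inputs behave like projections: the variational
inequality `IsMPCSolution.mpcForm_nonneg` yields uniqueness, Lipschitz dependence on x and, by
comparing two models, on θ. As only k < N matters, every Lipschitz constant produces some (C, ρ).

The cost bound is a Lyapunov argument for V_N(·;θ̂). Without mismatch V_N drops by (1-ε_N)ℓ per step
(`mpcValue_step_le`). The true successor misses the nominal one by at most L_Δ δ (‖x‖+‖u‖), whose
square is at most L_Δ² δ² M ℓ; by `mpcValue_le_add_alphaStar` this costs at most α⋆(δ)ℓ. The
remaining decrease (1-α⋆-ε_N)ℓ telescopes to J_∞ ≤ V_N(x;θ̂)/(1-α⋆-ε_N).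

It remains to compare V_N(x;θ̂) with V_N(x;θ) ≤ V_∞(x;θ). The factor 1+γ̄ is cost controllability.
For 1+β⋆ the θ-optimal inputs are fed to the nominal model (`mpcValue_le_mpcValue_add`): the inputs
agree, so only states deviate and ω plays no role. The second-order term is absorbed by
`le_add_sqrt_mul_of_perturbation`, so one linear term of β⋆ suffices.

Sublevel sets are invariant by continuity of V_N: a successor leaving the set would force a boundary
point, on the segment from the nominal successor, at which the decrease already applies
(`staysIn_of_sublevel_subset`). -/

namespace LQSystem

variable {n m p r : ℕ} (S : LQSystem n m p r)

/-! ### Costs, rollouts and existence of optimal inputs -/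

theorem zero_mem_inputSet : (0 : EuclideanSpace ℝ (Fin m)) ∈ S.inputSet := by
  intro i; simp

theorem isClosed_inputSet : IsClosed S.inputSet := by
  have h : S.inputSet = ⋂ i, {u | Matrix.toEuclideanLin S.E u i ≤ 1} := by
    ext u; simp [inputSet]
  rw [h]
  refine isClosed_iInter fun i => isClosed_le ?_ continuous_const
  have := (Matrix.toEuclideanLin S.E).continuous_of_finiteDimensional
  fun_prop

theorem convex_inputSet : Convex ℝ S.inputSet := by
  intro u hu v hv a b ha hb hab i
  have h1 := mul_le_mul_of_nonneg_left (hu i) ha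
  have h2 := mul_le_mul_of_nonneg_left (hv i) hb
  simp only [map_add, map_smul, PiLp.add_apply, PiLp.smul_apply, smul_eq_mul]
  linarith

theorem zero_mem_admissible : (0 : ℕ → EuclideanSpace ℝ (Fin m)) ∈ S.admissible :=
  fun _ => S.zero_mem_inputSet

@[simp] theorem costX_zero : S.costX 0 = 0 := by simp [costX]

@[simp] theorem costU_zero : S.costU 0 = 0 := by simp [costU]

theorem inner_toEuclideanLin_comm {k : ℕ} {Q : Matrix (Fin k) (Fin k) ℝ} (hQ : Q.IsHermitian)
    (x y : EuclideanSpace ℝ (Fin k)) :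
    inner ℝ x (Matrix.toEuclideanLin Q y) = inner ℝ y (Matrix.toEuclideanLin Q x) := by
  have h := (Matrix.isSymmetric_toEuclideanLin_iff (𝕜 := ℝ)).2 hQ
  rw [← h x y, real_inner_comm]

theorem costX_nonneg {a : ℝ} (ha : 0 < a) (hQm : ∀ x, a / 2 * ‖x‖ ^ 2 ≤ S.costX x) (x) :
    0 ≤ S.costX x := le_trans (by positivity) (hQm x)

theorem costU_nonneg {a : ℝ} (ha : 0 < a) (hRm : ∀ u, a / 2 * ‖u‖ ^ 2 ≤ S.costU u) (u) :
    0 ≤ S.costU u := le_trans (by positivity) (hRm u)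

theorem costStar_eq {a : ℝ} (ha : 0 < a) (hRm : ∀ u, a / 2 * ‖u‖ ^ 2 ≤ S.costU u) (x) :
    S.costStar x = S.costX x := by
  have : Nonempty S.inputSet := ⟨⟨0, S.zero_mem_inputSet⟩⟩
  have hlb : ∀ u : S.inputSet, S.costX x ≤ S.cost x u := fun u => by
    have := S.costU_nonneg ha hRm u
    simp only [cost]; linarith
  refine le_antisymm ?_ (le_ciInf hlb)
  refine (ciInf_le ⟨S.costX x, ?_⟩ (⟨0, S.zero_mem_inputSet⟩ : S.inputSet)).trans ?_
  · rintro _ ⟨u, rfl⟩; exact hlb u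
  · simp [cost]

@[simp] theorem rollout_zero (θ x) (u : ℕ → EuclideanSpace ℝ (Fin m)) :
    S.rollout θ x u 0 = x := rfl

theorem rollout_succ (θ x) (u : ℕ → EuclideanSpace ℝ (Fin m)) (k : ℕ) :
    S.rollout θ x u (k + 1) = S.step θ (S.rollout θ x u k) (u k) := rfl

theorem rollout_add (θ x y) (u v : ℕ → EuclideanSpace ℝ (Fin m)) (k : ℕ) :
    S.rollout θ (x + y) (u + v) k = S.rollout θ x u k + S.rollout θ y v k := by
  induction k with
  | zero => rfl
  | succ k ih => simp only [rollout_succ, ih, step, Pi.add_apply, map_add]; abel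

theorem rollout_smul (θ x) (a : ℝ) (u : ℕ → EuclideanSpace ℝ (Fin m)) (k : ℕ) :
    S.rollout θ (a • x) (a • u) k = a • S.rollout θ x u k := by
  induction k with
  | zero => rfl
  | succ k ih => simp only [rollout_succ, ih, step, Pi.smul_apply, map_smul, smul_add]

theorem rollout_sub (θ x y) (u v : ℕ → EuclideanSpace ℝ (Fin m)) (k : ℕ) :
    S.rollout θ (x - y) (u - v) k = S.rollout θ x u k - S.rollout θ y v k := by
  rw [eq_sub_iff_add_eq, ← rollout_add, sub_add_cancel, sub_add_cancel]

theorem rollout_congr (θ x) {u v : ℕ → EuclideanSpace ℝ (Fin m)} {k : ℕ}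
    (h : ∀ i < k, u i = v i) : S.rollout θ x u k = S.rollout θ x v k := by
  induction k with
  | zero => rfl
  | succ k ih => rw [rollout_succ, rollout_succ, ih fun i hi => h i (by omega), h k (by omega)]

theorem rollout_shift (θ x) (u : ℕ → EuclideanSpace ℝ (Fin m)) (j k : ℕ) :
    S.rollout θ x u (j + k) = S.rollout θ (S.rollout θ x u j) (fun i => u (j + i)) k := by
  induction k with
  | zero => rfl
  | succ k ih => rw [← add_assoc, rollout_succ, rollout_succ, ih]

theorem continuous_costX : Continuous S.costX := by
  have h1 := (Matrix.toEuclideanLin S.Q).continuous_of_finiteDimensional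
  unfold costX
  fun_prop

theorem continuous_costU : Continuous S.costU := by
  have h1 := (Matrix.toEuclideanLin S.R).continuous_of_finiteDimensional
  unfold costU
  fun_prop

theorem continuous_rollout {Y : Type*} [TopologicalSpace Y] (θ) {f : Y → EuclideanSpace ℝ (Fin n)}
    {g : Y → ℕ → EuclideanSpace ℝ (Fin m)} {k : ℕ} (hf : Continuous f)
    (hg : ∀ i < k, Continuous fun y => g y i) : Continuous fun y => S.rollout θ (f y) (g y) k := by
  induction k with
  | zero => exact hf
  | succ k ih =>
    have h1 := (Matrix.toEuclideanLin (S.A θ)).continuous_of_finiteDimensional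
    have h2 := (Matrix.toEuclideanLin (S.B θ)).continuous_of_finiteDimensional
    have h3 := ih fun i hi => hg i (by omega)
    have h4 := hg k (by omega)
    simp only [rollout_succ, step]
    exact (h1.comp h3).add (h2.comp h4)

theorem mpcCost_eq {a : ℝ} (ha : 0 < a) (hRm : ∀ u, a / 2 * ‖u‖ ^ 2 ≤ S.costU u) (N : ℕ) (θ x)
    (u : ℕ → EuclideanSpace ℝ (Fin m)) :
    S.mpcCost N θ x u = (∑ k ∈ range (N + 1), S.costX (S.rollout θ x u k)) +
      ∑ k ∈ range N, S.costU (u k) := by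
  rw [mpcCost, S.costStar_eq ha hRm, sum_range_succ]
  simp only [cost, sum_add_distrib]
  ring

theorem continuous_mpcCost {a : ℝ} (ha : 0 < a) (hRm : ∀ u, a / 2 * ‖u‖ ^ 2 ≤ S.costU u)
    {Y : Type*} [TopologicalSpace Y] (θ) {f : Y → EuclideanSpace ℝ (Fin n)}
    {g : Y → ℕ → EuclideanSpace ℝ (Fin m)} {N : ℕ} (hf : Continuous f)
    (hg : ∀ i < N, Continuous fun y => g y i) :
    Continuous fun y => S.mpcCost N θ (f y) (g y) := by
  simp only [S.mpcCost_eq ha hRm]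
  refine (continuous_finsetSum _ fun k hk => ?_).add (continuous_finsetSum _ fun k hk => ?_)
  · refine S.continuous_costX.comp (S.continuous_rollout θ hf fun i hi => hg i ?_)
    simp only [mem_range] at hk; omega
  · exact S.continuous_costU.comp (hg k (by simpa using hk))

theorem mpcCost_congr {N : ℕ} (θ x) {u v : ℕ → EuclideanSpace ℝ (Fin m)}
    (h : ∀ i < N, u i = v i) : S.mpcCost N θ x u = S.mpcCost N θ x v := by
  unfold mpcCost
  congr 1
  · refine sum_congr rfl fun k hk => ?_
    rw [mem_range] at hk
    rw [h k hk, S.rollout_congr θ x fun i hi => h i (by omega)]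
  · rw [S.rollout_congr θ x h]

theorem costX_rollout_le_mpcCost {a b : ℝ} (ha : 0 < a) (hb : 0 < b)
    (hQm : ∀ x, a / 2 * ‖x‖ ^ 2 ≤ S.costX x) (hRm : ∀ u, b / 2 * ‖u‖ ^ 2 ≤ S.costU u)
    {N k : ℕ} (hk : k ≤ N) (θ x) (u : ℕ → EuclideanSpace ℝ (Fin m)) :
    S.costX (S.rollout θ x u k) ≤ S.mpcCost N θ x u := by
  rw [S.mpcCost_eq hb hRm]
  have h1 := single_le_sum (f := fun k => S.costX (S.rollout θ x u k))
    (fun _ _ => S.costX_nonneg ha hQm _) (mem_range.2 (Nat.lt_succ_of_le hk))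
  have h2 := sum_nonneg fun i (_ : i ∈ range N) => S.costU_nonneg hb hRm (u i)
  linarith

theorem sum_costU_le_mpcCost {a b : ℝ} (ha : 0 < a) (hb : 0 < b)
    (hQm : ∀ x, a / 2 * ‖x‖ ^ 2 ≤ S.costX x) (hRm : ∀ u, b / 2 * ‖u‖ ^ 2 ≤ S.costU u)
    (N : ℕ) (θ x) (u : ℕ → EuclideanSpace ℝ (Fin m)) :
    ∑ k ∈ range N, S.costU (u k) ≤ S.mpcCost N θ x u := by
  rw [S.mpcCost_eq hb hRm]
  have h2 := sum_nonneg fun i (_ : i ∈ range (N + 1)) =>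
    S.costX_nonneg ha hQm (S.rollout θ x u i)
  linarith

theorem costU_le_mpcCost {a b : ℝ} (ha : 0 < a) (hb : 0 < b)
    (hQm : ∀ x, a / 2 * ‖x‖ ^ 2 ≤ S.costX x) (hRm : ∀ u, b / 2 * ‖u‖ ^ 2 ≤ S.costU u)
    {N k : ℕ} (hk : k < N) (θ x) (u : ℕ → EuclideanSpace ℝ (Fin m)) :
    S.costU (u k) ≤ S.mpcCost N θ x u :=
  (single_le_sum (f := fun k => S.costU (u k)) (fun _ _ => S.costU_nonneg hb hRm _)
    (mem_range.2 hk)).trans (S.sum_costU_le_mpcCost ha hb hQm hRm N θ x u)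

theorem mpcCost_nonneg {a b : ℝ} (ha : 0 < a) (hb : 0 < b)
    (hQm : ∀ x, a / 2 * ‖x‖ ^ 2 ≤ S.costX x) (hRm : ∀ u, b / 2 * ‖u‖ ^ 2 ≤ S.costU u)
    (N : ℕ) (θ x) (u : ℕ → EuclideanSpace ℝ (Fin m)) : 0 ≤ S.mpcCost N θ x u :=
  (S.costX_nonneg ha hQm x).trans
    (S.costX_rollout_le_mpcCost ha hb hQm hRm (Nat.zero_le N) θ x u)

theorem exists_isMPCSolution {a b : ℝ} (ha : 0 < a) (hb : 0 < b)
    (hQm : ∀ x, a / 2 * ‖x‖ ^ 2 ≤ S.costX x) (hRm : ∀ u, b / 2 * ‖u‖ ^ 2 ≤ S.costU u)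
    (N : ℕ) (θ x) : ∃ u, S.IsMPCSolution N θ x u := by
  set J := S.mpcCost N θ x
  have hJ0 : 0 ≤ J 0 := S.mpcCost_nonneg ha hb hQm hRm N θ x 0
  -- At norm s a single input already costs as much as the whole zero sequence, so larger inputs
  -- cannot help.
  set s := √(2 * J 0 / b)
  have hs : b / 2 * s ^ 2 = J 0 := by
    rw [Real.sq_sqrt (by positivity)]; field_simp
  set K : Set (ℕ → EuclideanSpace ℝ (Fin m)) :=
    Set.pi Set.univ fun _ => S.inputSet ∩ Metric.closedBall 0 s
  have hK : IsCompact K := isCompact_univ_pi fun _ =>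
    (isCompact_closedBall _ _).inter_left S.isClosed_inputSet
  have h0 : (0 : ℕ → EuclideanSpace ℝ (Fin m)) ∈ K := fun i _ =>
    ⟨S.zero_mem_inputSet, by simp [s]⟩
  have hc : Continuous J := S.continuous_mpcCost hb hRm θ continuous_const
    fun _ _ => continuous_apply _
  obtain ⟨u, huK, hu⟩ := hK.exists_isMinOn ⟨0, h0⟩ hc.continuousOn
  refine ⟨u, fun k => (huK k trivial).1, fun v hv => ?_⟩
  by_cases hvs : ∀ k < N, ‖v k‖ ≤ s
  -- The entries with k ≥ N are unconstrained in norm but invisible to the objective; zeroing them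
  -- puts the competitor into the compact set.
  · have hw : (fun k => if k < N then v k else 0) ∈ K := by
      intro k _
      by_cases hk : k < N
      · simpa [hk] using ⟨hv k, hvs k hk⟩
      · simpa [hk] using ⟨S.zero_mem_inputSet, Real.sqrt_nonneg _⟩
    calc J u ≤ _ := hu hw
      _ = J v := S.mpcCost_congr θ x fun i hi => by simp [hi]
  · push Not at hvs
    obtain ⟨k, hk, hks⟩ := hvs
    calc J u ≤ J 0 := hu h0
      _ = b / 2 * s ^ 2 := hs.symm
      _ ≤ b / 2 * ‖v k‖ ^ 2 := by gcongr
      _ ≤ S.costU (v k) := hRm _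
      _ ≤ J v := S.costU_le_mpcCost ha hb hQm hRm hk θ x v

theorem isMPCSolution_mpcInput {a b : ℝ} (ha : 0 < a) (hb : 0 < b)
    (hQm : ∀ x, a / 2 * ‖x‖ ^ 2 ≤ S.costX x) (hRm : ∀ u, b / 2 * ‖u‖ ^ 2 ≤ S.costU u)
    (N : ℕ) (θ x) : S.IsMPCSolution N θ x (S.mpcInput N θ x) := by
  have h := S.exists_isMPCSolution ha hb hQm hRm N θ x
  rw [mpcInput, dif_pos h]
  exact h.choose_spec

theorem mpcValue_le {a b : ℝ} (ha : 0 < a) (hb : 0 < b)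
    (hQm : ∀ x, a / 2 * ‖x‖ ^ 2 ≤ S.costX x) (hRm : ∀ u, b / 2 * ‖u‖ ^ 2 ≤ S.costU u)
    (N : ℕ) (θ x) {u : ℕ → EuclideanSpace ℝ (Fin m)} (hu : u ∈ S.admissible) :
    S.mpcValue N θ x ≤ S.mpcCost N θ x u := by
  refine ciInf_le ⟨0, ?_⟩ (⟨u, hu⟩ : S.admissible)
  rintro _ ⟨v, rfl⟩
  exact S.mpcCost_nonneg ha hb hQm hRm N θ x v

theorem mpcValue_eq {a b : ℝ} (ha : 0 < a) (hb : 0 < b)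
    (hQm : ∀ x, a / 2 * ‖x‖ ^ 2 ≤ S.costX x) (hRm : ∀ u, b / 2 * ‖u‖ ^ 2 ≤ S.costU u)
    (N : ℕ) (θ x) : S.mpcValue N θ x = S.mpcCost N θ x (S.mpcInput N θ x) := by
  have h := S.isMPCSolution_mpcInput ha hb hQm hRm N θ x
  have : Nonempty S.admissible := ⟨⟨_, h.1⟩⟩
  exact le_antisymm (S.mpcValue_le ha hb hQm hRm N θ x h.1) (le_ciInf fun v => h.2 v v.2)

/-! ### The objective as a quadratic form: first-order optimality and uniqueness -/

/-- The symmetric bilinear form of the quadratic `(x, u) ↦ J_N(x; u, θ)`. -/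
noncomputable def mpcForm (N : ℕ) (θ : EuclideanSpace ℝ (Fin p)) (x : EuclideanSpace ℝ (Fin n))
    (u : ℕ → EuclideanSpace ℝ (Fin m)) (y : EuclideanSpace ℝ (Fin n))
    (v : ℕ → EuclideanSpace ℝ (Fin m)) : ℝ :=
  (∑ k ∈ range (N + 1),
    inner ℝ (S.rollout θ x u k) (Matrix.toEuclideanLin S.Q (S.rollout θ y v k))) +
    ∑ k ∈ range N, inner ℝ (u k) (Matrix.toEuclideanLin S.R (v k))

theorem mpcForm_self {a : ℝ} (ha : 0 < a) (hRm : ∀ u, a / 2 * ‖u‖ ^ 2 ≤ S.costU u) (N : ℕ) (θ x)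
    (u : ℕ → EuclideanSpace ℝ (Fin m)) : S.mpcForm N θ x u x u = S.mpcCost N θ x u := by
  rw [S.mpcCost_eq ha hRm]; rfl

theorem mpcForm_sub_left (N : ℕ) (θ x x' y) (u u' v : ℕ → EuclideanSpace ℝ (Fin m)) :
    S.mpcForm N θ (x - x') (u - u') y v = S.mpcForm N θ x u y v - S.mpcForm N θ x' u' y v := by
  simp only [mpcForm, rollout_sub, inner_sub_left, Pi.sub_apply, sum_sub_distrib]
  ring

theorem mpcForm_comm (hQ : S.Q.IsHermitian) (hR : S.R.IsHermitian) (N : ℕ) (θ x y)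
    (u v : ℕ → EuclideanSpace ℝ (Fin m)) :
    S.mpcForm N θ x u y v = S.mpcForm N θ y v x u := by
  unfold mpcForm
  congr 1
  · exact sum_congr rfl fun k _ => inner_toEuclideanLin_comm hQ _ _
  · exact sum_congr rfl fun k _ => inner_toEuclideanLin_comm hR _ _

theorem mpcForm_smul_left (N : ℕ) (θ x y) (s : ℝ) (u v : ℕ → EuclideanSpace ℝ (Fin m)) :
    S.mpcForm N θ (s • x) (s • u) y v = s * S.mpcForm N θ x u y v := by
  simp only [mpcForm, rollout_smul, real_inner_smul_left, Pi.smul_apply, mul_add, mul_sum]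

theorem mpcForm_sub_right (hQ : S.Q.IsHermitian) (hR : S.R.IsHermitian) (N : ℕ) (θ x y y')
    (u v v' : ℕ → EuclideanSpace ℝ (Fin m)) :
    S.mpcForm N θ x u (y - y') (v - v') = S.mpcForm N θ x u y v - S.mpcForm N θ x u y' v' := by
  rw [S.mpcForm_comm hQ hR, mpcForm_sub_left, S.mpcForm_comm hQ hR N θ y,
    S.mpcForm_comm hQ hR N θ y']

theorem mpcForm_smul_right (hQ : S.Q.IsHermitian) (hR : S.R.IsHermitian) (N : ℕ) (θ x y) (s : ℝ)
    (u v : ℕ → EuclideanSpace ℝ (Fin m)) :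
    S.mpcForm N θ x u (s • y) (s • v) = s * S.mpcForm N θ x u y v := by
  rw [S.mpcForm_comm hQ hR, mpcForm_smul_left, S.mpcForm_comm hQ hR N θ y]

theorem mpcCost_sub {b : ℝ} (hb : 0 < b) (hRm : ∀ u, b / 2 * ‖u‖ ^ 2 ≤ S.costU u)
    (hQ : S.Q.IsHermitian) (hR : S.R.IsHermitian) (N : ℕ) (θ x y)
    (u v : ℕ → EuclideanSpace ℝ (Fin m)) :
    S.mpcCost N θ (x - y) (u - v) =
      S.mpcCost N θ x u - 2 * S.mpcForm N θ x u y v + S.mpcCost N θ y v := by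
  rw [← S.mpcForm_self hb hRm, mpcForm_sub_left, S.mpcForm_sub_right hQ hR,
    S.mpcForm_sub_right hQ hR, S.mpcForm_comm hQ hR N θ y x, S.mpcForm_self hb hRm,
    S.mpcForm_self hb hRm]
  ring

theorem mpcCost_smul {b : ℝ} (hb : 0 < b) (hRm : ∀ u, b / 2 * ‖u‖ ^ 2 ≤ S.costU u)
    (hQ : S.Q.IsHermitian) (hR : S.R.IsHermitian) (N : ℕ) (θ x) (s : ℝ)
    (u : ℕ → EuclideanSpace ℝ (Fin m)) :
    S.mpcCost N θ (s • x) (s • u) = s ^ 2 * S.mpcCost N θ x u := by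
  rw [← S.mpcForm_self hb hRm, mpcForm_smul_left, S.mpcForm_smul_right hQ hR,
    S.mpcForm_self hb hRm]
  ring

/-- The variational inequality that characterizes solutions of the MPC problem. -/
theorem IsMPCSolution.mpcForm_nonneg {S : LQSystem n m p r} {a b : ℝ} (ha : 0 < a) (hb : 0 < b)
    (hQm : ∀ x, a / 2 * ‖x‖ ^ 2 ≤ S.costX x) (hRm : ∀ u, b / 2 * ‖u‖ ^ 2 ≤ S.costU u)
    (hQ : S.Q.IsHermitian) (hR : S.R.IsHermitian) {N : ℕ} {θ x}
    {u v : ℕ → EuclideanSpace ℝ (Fin m)} (hu : S.IsMPCSolution N θ x u) (hv : v ∈ S.admissible) :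
    0 ≤ S.mpcForm N θ x u 0 (v - u) := by
  set F := S.mpcForm N θ x u 0 (v - u) with hF
  set D := S.mpcCost N θ 0 (v - u) with hD
  have hD0 : 0 ≤ D := S.mpcCost_nonneg ha hb hQm hRm N θ 0 _
  have key : ∀ s : ℝ, 0 < s → s ≤ 1 → 0 ≤ 2 * F + s * D := by
    intro s hs hs1
    -- This is the point u + s(v - u) of the segment, written as a difference to fit `mpcCost_sub`.
    have hw : u - (-s) • (v - u) ∈ S.admissible := fun k => by
      have := S.convex_inputSet (hu.1 k) (hv k) (sub_nonneg.2 hs1) hs.le (by ring)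
      convert this using 1
      simp only [Pi.sub_apply, Pi.smul_apply]
      module
    have h1 := hu.2 _ hw
    have h2 := S.mpcCost_sub hb hRm hQ hR N θ x ((-s) • 0) u ((-s) • (v - u))
    rw [S.mpcForm_smul_right hQ hR, S.mpcCost_smul hb hRm hQ hR, ← hF, ← hD, smul_zero,
      sub_zero] at h2
    rw [h2] at h1
    have h3 : 0 ≤ s * (2 * F + s * D) := by nlinarith
    exact nonneg_of_mul_nonneg_right h3 hs
  by_contra! hneg
  -- At this step length the quadratic term sD is less than -F, so 2F + sD would be negative.
  have h1 : 0 < -F / (D + 1) := div_pos (by linarith) (by linarith)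
  have h2 := key (min 1 (-F / (D + 1))) (lt_min one_pos h1) (min_le_left _ _)
  have h3 : min 1 (-F / (D + 1)) * D ≤ -F / (D + 1) * D := by
    gcongr; exact min_le_right _ _
  have h4 : -F / (D + 1) * D = -F - -F / (D + 1) := by field_simp; ring
  linarith

/-- The optimal inputs depend on the initial state in a non-expansive way, measured by the
objective. -/
theorem IsMPCSolution.mpcCost_sub_le {S : LQSystem n m p r} {a b : ℝ} (ha : 0 < a) (hb : 0 < b)
    (hQm : ∀ x, a / 2 * ‖x‖ ^ 2 ≤ S.costX x) (hRm : ∀ u, b / 2 * ‖u‖ ^ 2 ≤ S.costU u)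
    (hQ : S.Q.IsHermitian) (hR : S.R.IsHermitian) {N : ℕ} {θ x y}
    {u v : ℕ → EuclideanSpace ℝ (Fin m)} (hu : S.IsMPCSolution N θ x u)
    (hv : S.IsMPCSolution N θ y v) :
    S.mpcCost N θ 0 (v - u) ≤ S.mpcCost N θ (x - y) 0 := by
  -- Write B for `mpcForm`. The two variational inequalities add up to J(0,v-u) ≤
  -- B((x-y,0),(0,v-u)), and J(x-y,u-v) ≥ 0 bounds 2B by J(x-y,0) + J(0,v-u).
  have h1 := hu.mpcForm_nonneg ha hb hQm hRm hQ hR hv.1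
  have h2 := hv.mpcForm_nonneg ha hb hQm hRm hQ hR hu.1
  have h3 : S.mpcForm N θ y v 0 (u - v) = - S.mpcForm N θ y v 0 (v - u) := by
    have := S.mpcForm_smul_right hQ hR N θ y 0 (-1) v (v - u)
    simpa using this
  have h4 := S.mpcForm_sub_left N θ x y 0 u v (v - u)
  have h5 := S.mpcForm_sub_left N θ (x - y) 0 0 0 (v - u) (v - u)
  have h6 := S.mpcCost_sub hb hRm hQ hR N θ (x - y) 0 0 (v - u)
  have h7 := S.mpcCost_nonneg ha hb hQm hRm N θ (x - y - 0) (0 - (v - u))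
  rw [sub_zero, zero_sub, neg_sub, h4, S.mpcForm_self hb hRm] at h5
  linarith

theorem mpcCost_zero_zero {b : ℝ} (hb : 0 < b) (hRm : ∀ u, b / 2 * ‖u‖ ^ 2 ≤ S.costU u)
    (N : ℕ) (θ) : S.mpcCost N θ 0 0 = 0 := by
  have h : ∀ k, S.rollout θ 0 0 k = 0 := fun k => by
    have := S.rollout_smul θ 0 0 0 k
    simpa using this
  simp [S.mpcCost_eq hb hRm, h]

theorem IsMPCSolution.unique {S : LQSystem n m p r} {a b : ℝ} (ha : 0 < a) (hb : 0 < b)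
    (hQm : ∀ x, a / 2 * ‖x‖ ^ 2 ≤ S.costX x) (hRm : ∀ u, b / 2 * ‖u‖ ^ 2 ≤ S.costU u)
    (hQ : S.Q.IsHermitian) (hR : S.R.IsHermitian) {N : ℕ} {θ x}
    {u v : ℕ → EuclideanSpace ℝ (Fin m)} (hu : S.IsMPCSolution N θ x u)
    (hv : S.IsMPCSolution N θ x v) {k : ℕ} (hk : k < N) : v k = u k := by
  have h1 := hu.mpcCost_sub_le ha hb hQm hRm hQ hR hv
  have h2 := (hRm _).trans (S.costU_le_mpcCost ha hb hQm hRm hk θ 0 (v - u))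
  have h3 : S.mpcCost N θ (x - x) 0 = 0 := by
    rw [sub_self, S.mpcCost_zero_zero hb hRm]
  have h4 : ‖(v - u) k‖ ^ 2 ≤ 0 := by
    by_contra! h
    have : 0 < b / 2 * ‖(v - u) k‖ ^ 2 := by positivity
    linarith
  have h5 : ‖(v - u) k‖ = 0 := pow_eq_zero_iff two_ne_zero |>.1 (le_antisymm h4 (sq_nonneg _))
  exact sub_eq_zero.1 (norm_eq_zero.1 h5)

/-! ### Lipschitz dependence of the optimal inputs on state and parameter -/

theorem norm_step_le {θ} {L : ℝ} (hA : ∀ x, ‖Matrix.toEuclideanLin (S.A θ) x‖ ≤ L * ‖x‖)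
    (hB : ∀ u, ‖Matrix.toEuclideanLin (S.B θ) u‖ ≤ L * ‖u‖) (x u) :
    ‖S.step θ x u‖ ≤ L * (‖x‖ + ‖u‖) :=
  (norm_add_le _ _).trans (by linarith [hA x, hB u])

theorem norm_rollout_le {θ} {L : ℝ} (hL : 1 ≤ L)
    (hA : ∀ x, ‖Matrix.toEuclideanLin (S.A θ) x‖ ≤ L * ‖x‖)
    (hB : ∀ u, ‖Matrix.toEuclideanLin (S.B θ) u‖ ≤ L * ‖u‖) (x)
    (u : ℕ → EuclideanSpace ℝ (Fin m)) (k : ℕ) :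
    ‖S.rollout θ x u k‖ ≤ L ^ k * (‖x‖ + ∑ i ∈ range k, ‖u i‖) := by
  induction k with
  | zero => simp
  | succ k ih =>
    have h1 : 1 ≤ L ^ k := one_le_pow₀ hL
    calc _ ≤ L * (‖S.rollout θ x u k‖ + ‖u k‖) := S.norm_step_le hA hB _ _
      _ ≤ L * (L ^ k * (‖x‖ + ∑ i ∈ range k, ‖u i‖) + L ^ k * ‖u k‖) := by
        gcongr
        exact le_mul_of_one_le_left (norm_nonneg _) h1
      _ = _ := by rw [sum_range_succ]; ring

theorem norm_rollout_le' {θ} {L : ℝ} (hL : 1 ≤ L)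
    (hA : ∀ x, ‖Matrix.toEuclideanLin (S.A θ) x‖ ≤ L * ‖x‖)
    (hB : ∀ u, ‖Matrix.toEuclideanLin (S.B θ) u‖ ≤ L * ‖u‖) (x)
    (u : ℕ → EuclideanSpace ℝ (Fin m)) {k N : ℕ} (hk : k ≤ N) :
    ‖S.rollout θ x u k‖ ≤ L ^ N * (‖x‖ + ∑ i ∈ range N, ‖u i‖) := by
  refine (S.norm_rollout_le hL hA hB x u k).trans ?_
  gcongr

theorem step_sub_step (θ θ' x x' u) : S.step θ x u - S.step θ' x' u =
    Matrix.toEuclideanLin (S.A θ') (x - x') + Matrix.toEuclideanLin (S.A θ - S.A θ') x +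
      Matrix.toEuclideanLin (S.B θ - S.B θ') u := by
  simp only [step, map_sub, LinearMap.sub_apply]
  abel

theorem norm_rollout_sub_rollout_le {θ θ'} {L d : ℝ} (hL : 1 ≤ L) (hd : 0 ≤ d)
    (hA : ∀ x, ‖Matrix.toEuclideanLin (S.A θ) x‖ ≤ L * ‖x‖)
    (hB : ∀ u, ‖Matrix.toEuclideanLin (S.B θ) u‖ ≤ L * ‖u‖)
    (hA' : ∀ x, ‖Matrix.toEuclideanLin (S.A θ') x‖ ≤ L * ‖x‖)
    (hΔA : ∀ x, ‖Matrix.toEuclideanLin (S.A θ - S.A θ') x‖ ≤ d * ‖x‖)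
    (hΔB : ∀ u, ‖Matrix.toEuclideanLin (S.B θ - S.B θ') u‖ ≤ d * ‖u‖) (x)
    (u : ℕ → EuclideanSpace ℝ (Fin m)) (k : ℕ) :
    ‖S.rollout θ x u k - S.rollout θ' x u k‖ ≤
      k * L ^ k * d * (‖x‖ + ∑ i ∈ range k, ‖u i‖) := by
  induction k with
  | zero => simp
  | succ k ih =>
    have h1 : 1 ≤ L ^ k := one_le_pow₀ hL
    have h2 := S.norm_rollout_le hL hA hB x u k
    set s := ‖x‖ + ∑ i ∈ range k, ‖u i‖ with hs
    have hs0 : 0 ≤ s := by positivity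
    rw [rollout_succ, rollout_succ, step_sub_step]
    calc _ ≤ _ := norm_add₃_le
      _ ≤ L * (k * L ^ k * d * s) + d * (L ^ k * s) + d * ‖u k‖ := by
        refine add_le_add_three ((hA' _).trans ?_) ((hΔA _).trans ?_) (hΔB _) <;> gcongr
      _ ≤ L * (k * L ^ k * d * s) + d * (L ^ (k + 1) * s) + (k + 1) * L ^ (k + 1) * d * ‖u k‖ := by
        have h3 : L ^ k ≤ L ^ (k + 1) := pow_le_pow_right₀ hL (by omega)
        have h4 : 1 ≤ (k + 1) * L ^ (k + 1) := by
          have : (1 : ℝ) ≤ k + 1 := by simp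
          nlinarith
        have h5 : d * ‖u k‖ ≤ (k + 1) * L ^ (k + 1) * (d * ‖u k‖) :=
          le_mul_of_one_le_left (by positivity) h4
        have h6 : d * (L ^ k * s) ≤ d * (L ^ (k + 1) * s) := by gcongr
        linarith
      _ = _ := by rw [sum_range_succ, ← add_assoc, ← hs]; push_cast; ring

theorem norm_rollout_sub_rollout_le' {θ θ'} {L d : ℝ} (hL : 1 ≤ L) (hd : 0 ≤ d)
    (hA : ∀ x, ‖Matrix.toEuclideanLin (S.A θ) x‖ ≤ L * ‖x‖)
    (hB : ∀ u, ‖Matrix.toEuclideanLin (S.B θ) u‖ ≤ L * ‖u‖)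
    (hA' : ∀ x, ‖Matrix.toEuclideanLin (S.A θ') x‖ ≤ L * ‖x‖)
    (hΔA : ∀ x, ‖Matrix.toEuclideanLin (S.A θ - S.A θ') x‖ ≤ d * ‖x‖)
    (hΔB : ∀ u, ‖Matrix.toEuclideanLin (S.B θ - S.B θ') u‖ ≤ d * ‖u‖) (x)
    (u : ℕ → EuclideanSpace ℝ (Fin m)) {k N : ℕ} (hk : k ≤ N) :
    ‖S.rollout θ x u k - S.rollout θ' x u k‖ ≤
      N * L ^ N * d * (‖x‖ + ∑ i ∈ range N, ‖u i‖) := by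
  refine (S.norm_rollout_sub_rollout_le hL hd hA hB hA' hΔA hΔB x u k).trans ?_
  gcongr

theorem costX_le {Lx : ℝ} (hQL : ∀ x, ‖(2 : ℝ) • Matrix.toEuclideanLin S.Q x‖ ≤ Lx * ‖x‖) (x) :
    S.costX x ≤ Lx / 2 * ‖x‖ ^ 2 := by
  have h1 := real_inner_le_norm x ((2 : ℝ) • Matrix.toEuclideanLin S.Q x)
  rw [real_inner_smul_right] at h1
  have h2 := mul_le_mul_of_nonneg_left (hQL x) (norm_nonneg x)
  unfold costX
  nlinarith

theorem mpcCost_zero_le {Lx L b : ℝ} (hb : 0 < b) (hRm : ∀ u, b / 2 * ‖u‖ ^ 2 ≤ S.costU u)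
    (hQL : ∀ x, ‖(2 : ℝ) • Matrix.toEuclideanLin S.Q x‖ ≤ Lx * ‖x‖) (hLx : 0 < Lx) {θ}
    (hL : 1 ≤ L) (hA : ∀ x, ‖Matrix.toEuclideanLin (S.A θ) x‖ ≤ L * ‖x‖)
    (hB : ∀ u, ‖Matrix.toEuclideanLin (S.B θ) u‖ ≤ L * ‖u‖) (N : ℕ) (x) :
    S.mpcCost N θ x 0 ≤ (N + 1) * (Lx / 2 * (L ^ N) ^ 2) * ‖x‖ ^ 2 := by
  rw [S.mpcCost_eq hb hRm]
  have h : ∀ k ∈ range (N + 1), S.costX (S.rollout θ x 0 k) ≤ Lx / 2 * (L ^ N * ‖x‖) ^ 2 := by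
    intro k hk
    have := S.norm_rollout_le' hL hA hB x 0 (mem_range_succ_iff.1 hk)
    refine (S.costX_le hQL _).trans ?_
    gcongr
    simpa using this
  have h2 := sum_le_card_nsmul _ _ _ h
  simp only [card_range, nsmul_eq_mul, Nat.cast_add, Nat.cast_one] at h2
  simp only [Pi.zero_apply, costU_zero, sum_const_zero, add_zero]
  linarith

theorem norm_mpcInput_sub_le {Lx L a b : ℝ} (ha : 0 < a) (hb : 0 < b)
    (hQm : ∀ x, a / 2 * ‖x‖ ^ 2 ≤ S.costX x) (hRm : ∀ u, b / 2 * ‖u‖ ^ 2 ≤ S.costU u)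
    (hQ : S.Q.IsHermitian) (hR : S.R.IsHermitian)
    (hQL : ∀ x, ‖(2 : ℝ) • Matrix.toEuclideanLin S.Q x‖ ≤ Lx * ‖x‖) (hLx : 0 < Lx) {θ}
    (hL : 1 ≤ L) (hA : ∀ x, ‖Matrix.toEuclideanLin (S.A θ) x‖ ≤ L * ‖x‖)
    (hB : ∀ u, ‖Matrix.toEuclideanLin (S.B θ) u‖ ≤ L * ‖u‖) (N : ℕ) (x y) {k : ℕ} (hk : k < N) :
    ‖S.mpcInput N θ x k - S.mpcInput N θ y k‖ ≤
      √((N + 1) * (Lx / b) * (L ^ N) ^ 2) * ‖x - y‖ := by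
  have h1 := (S.isMPCSolution_mpcInput ha hb hQm hRm N θ y).mpcCost_sub_le ha hb hQm hRm hQ hR
    (S.isMPCSolution_mpcInput ha hb hQm hRm N θ x)
  have h2 := S.mpcCost_zero_le hb hRm hQL hLx hL hA hB N (y - x)
  have h3 := (hRm _).trans (S.costU_le_mpcCost ha hb hQm hRm hk θ 0
    (S.mpcInput N θ x - S.mpcInput N θ y))
  refine (sq_le_sq₀ (norm_nonneg _) (by positivity)).1 ?_
  rw [mul_pow, Real.sq_sqrt (by positivity), norm_sub_rev x y]
  have h4 := h3.trans (h1.trans h2)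
  rw [Pi.sub_apply] at h4
  have h5 := mul_le_mul_of_nonneg_left h4 (show 0 ≤ 2 / b by positivity)
  calc _ = 2 / b * (b / 2 * ‖S.mpcInput N θ x k - S.mpcInput N θ y k‖ ^ 2) := by field_simp
    _ ≤ _ := h5
    _ = _ := by field_simp

theorem norm_mpcInput_le {Lx L a b : ℝ} (ha : 0 < a) (hb : 0 < b)
    (hQm : ∀ x, a / 2 * ‖x‖ ^ 2 ≤ S.costX x) (hRm : ∀ u, b / 2 * ‖u‖ ^ 2 ≤ S.costU u)
    (hQ : S.Q.IsHermitian) (hR : S.R.IsHermitian)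
    (hQL : ∀ x, ‖(2 : ℝ) • Matrix.toEuclideanLin S.Q x‖ ≤ Lx * ‖x‖) (hLx : 0 < Lx) {θ}
    (hL : 1 ≤ L) (hA : ∀ x, ‖Matrix.toEuclideanLin (S.A θ) x‖ ≤ L * ‖x‖)
    (hB : ∀ u, ‖Matrix.toEuclideanLin (S.B θ) u‖ ≤ L * ‖u‖) (N : ℕ) (x) {k : ℕ} (hk : k < N) :
    ‖S.mpcInput N θ x k‖ ≤ √((N + 1) * (Lx / b) * (L ^ N) ^ 2) * ‖x‖ := by
  -- Zero inputs are optimal at the origin, so the Lipschitz bound becomes a linear growth bound.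
  have h0 : S.IsMPCSolution N θ 0 0 := ⟨S.zero_mem_admissible, fun v _ => by
    rw [S.mpcCost_zero_zero hb hRm]; exact S.mpcCost_nonneg ha hb hQm hRm N θ 0 v⟩
  have h1 := h0.unique ha hb hQm hRm hQ hR (S.isMPCSolution_mpcInput ha hb hQm hRm N θ 0) hk
  have h2 := S.norm_mpcInput_sub_le ha hb hQm hRm hQ hR hQL hLx hL hA hB N x 0 hk
  simpa [h1] using h2

theorem mpcForm_sub_mpcForm_le {θ θ'} {Lx L d : ℝ} (hLx : 0 < Lx) (hL : 1 ≤ L) (hd : 0 ≤ d)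
    (hQL : ∀ x, ‖(2 : ℝ) • Matrix.toEuclideanLin S.Q x‖ ≤ Lx * ‖x‖)
    (hA : ∀ x, ‖Matrix.toEuclideanLin (S.A θ) x‖ ≤ L * ‖x‖)
    (hB : ∀ u, ‖Matrix.toEuclideanLin (S.B θ) u‖ ≤ L * ‖u‖)
    (hA' : ∀ x, ‖Matrix.toEuclideanLin (S.A θ') x‖ ≤ L * ‖x‖)
    (hB' : ∀ u, ‖Matrix.toEuclideanLin (S.B θ') u‖ ≤ L * ‖u‖)
    (hΔA : ∀ x, ‖Matrix.toEuclideanLin (S.A θ - S.A θ') x‖ ≤ d * ‖x‖)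
    (hΔB : ∀ u, ‖Matrix.toEuclideanLin (S.B θ - S.B θ') u‖ ≤ d * ‖u‖) (N : ℕ) (x y)
    (v w : ℕ → EuclideanSpace ℝ (Fin m)) :
    S.mpcForm N θ x v y w - S.mpcForm N θ' x v y w ≤
      (N + 1) * (Lx * (N * L ^ N * d) * L ^ N) * (‖x‖ + ∑ i ∈ range N, ‖v i‖) *
        (‖y‖ + ∑ i ∈ range N, ‖w i‖) := by
  set s := ‖x‖ + ∑ i ∈ range N, ‖v i‖
  set t := ‖y‖ + ∑ i ∈ range N, ‖w i‖
  have hQ : ∀ z, ‖Matrix.toEuclideanLin S.Q z‖ ≤ Lx / 2 * ‖z‖ := fun z => by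
    have := hQL z
    rw [norm_smul, Real.norm_ofNat] at this
    linarith
  have hterm : ∀ k ∈ range (N + 1),
      inner ℝ (S.rollout θ x v k) (Matrix.toEuclideanLin S.Q (S.rollout θ y w k)) -
        inner ℝ (S.rollout θ' x v k) (Matrix.toEuclideanLin S.Q (S.rollout θ' y w k)) ≤
      Lx * (N * L ^ N * d) * L ^ N * s * t := by
    intro k hk
    have hk' := mem_range_succ_iff.1 hk
    have h1 := S.norm_rollout_sub_rollout_le' hL hd hA hB hA' hΔA hΔB x v hk'
    have h2 := S.norm_rollout_sub_rollout_le' hL hd hA hB hA' hΔA hΔB y w hk'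
    have h3 := S.norm_rollout_le' hL hA' hB' x v hk'
    have h4 := S.norm_rollout_le' hL hA hB y w hk'
    set ξ := S.rollout θ x v k
    set ξ' := S.rollout θ' x v k
    set η := S.rollout θ y w k
    set η' := S.rollout θ' y w k
    have e : inner ℝ ξ (Matrix.toEuclideanLin S.Q η) - inner ℝ ξ' (Matrix.toEuclideanLin S.Q η') =
        inner ℝ (ξ - ξ') (Matrix.toEuclideanLin S.Q η) +
          inner ℝ ξ' (Matrix.toEuclideanLin S.Q (η - η')) := by
      rw [inner_sub_left, map_sub, inner_sub_right]; ring
    have h5 := real_inner_le_norm (ξ - ξ') (Matrix.toEuclideanLin S.Q η)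
    have h6 := real_inner_le_norm ξ' (Matrix.toEuclideanLin S.Q (η - η'))
    have h7 : ‖ξ - ξ'‖ * ‖Matrix.toEuclideanLin S.Q η‖ ≤
        N * L ^ N * d * s * (Lx / 2 * (L ^ N * t)) := by
      have := hQ η
      gcongr
      exact this.trans (by gcongr)
    have h8 : ‖ξ'‖ * ‖Matrix.toEuclideanLin S.Q (η - η')‖ ≤
        L ^ N * s * (Lx / 2 * (N * L ^ N * d * t)) := by
      have := hQ (η - η')
      gcongr
      exact this.trans (by gcongr)
    rw [e]
    linarith
  have h := sum_le_card_nsmul _ _ _ hterm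
  simp only [card_range, nsmul_eq_mul, Nat.cast_add, Nat.cast_one, sum_sub_distrib] at h
  unfold mpcForm
  linarith

/-- Testing each model's variational inequality with the other's optimiser bounds J_θ(0,v-u) by the
difference of the two bilinear forms at (x,v) and (0,v-u). That difference is linear in v-u and in
d, while J_θ is quadratically coercive in the inputs. -/
theorem norm_mpcInput_sub_mpcInput_le {θ θ'} {Lx L a b d : ℝ} (ha : 0 < a) (hb : 0 < b)
    (hQm : ∀ x, a / 2 * ‖x‖ ^ 2 ≤ S.costX x) (hRm : ∀ u, b / 2 * ‖u‖ ^ 2 ≤ S.costU u)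
    (hQ : S.Q.IsHermitian) (hR : S.R.IsHermitian) (hLx : 0 < Lx) (hL : 1 ≤ L) (hd : 0 ≤ d)
    (hQL : ∀ x, ‖(2 : ℝ) • Matrix.toEuclideanLin S.Q x‖ ≤ Lx * ‖x‖)
    (hA : ∀ x, ‖Matrix.toEuclideanLin (S.A θ) x‖ ≤ L * ‖x‖)
    (hB : ∀ u, ‖Matrix.toEuclideanLin (S.B θ) u‖ ≤ L * ‖u‖)
    (hA' : ∀ x, ‖Matrix.toEuclideanLin (S.A θ') x‖ ≤ L * ‖x‖)
    (hB' : ∀ u, ‖Matrix.toEuclideanLin (S.B θ') u‖ ≤ L * ‖u‖)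
    (hΔA : ∀ x, ‖Matrix.toEuclideanLin (S.A θ - S.A θ') x‖ ≤ d * ‖x‖)
    (hΔB : ∀ u, ‖Matrix.toEuclideanLin (S.B θ - S.B θ') u‖ ≤ d * ‖u‖) (N : ℕ) (x) {k : ℕ}
    (hk : k < N) :
    ‖S.mpcInput N θ x k - S.mpcInput N θ' x k‖ ≤
      2 / b * N * ((N + 1) * (Lx * (N * L ^ N) * L ^ N)) *
        (1 + N * √((N + 1) * (Lx / b) * (L ^ N) ^ 2)) * d * ‖x‖ := by
  have hu := S.isMPCSolution_mpcInput ha hb hQm hRm N θ x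
  have hv := S.isMPCSolution_mpcInput ha hb hQm hRm N θ' x
  have hvn : ∀ i ∈ range N, ‖S.mpcInput N θ' x i‖ ≤ _ := fun i hi =>
    S.norm_mpcInput_le ha hb hQm hRm hQ hR hQL hLx hL hA' hB' N x (mem_range.1 hi)
  set C := √((N + 1) * (Lx / b) * (L ^ N) ^ 2)
  set K := (N + 1) * (Lx * (N * L ^ N) * L ^ N)
  have hK : 0 ≤ K := by positivity
  set u := S.mpcInput N θ x
  set v := S.mpcInput N θ' x
  have hs := sum_le_card_nsmul _ _ _ hvn
  rw [card_range, nsmul_eq_mul] at hs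
  have h1 := hu.mpcForm_nonneg ha hb hQm hRm hQ hR hv.1
  have h2 := hv.mpcForm_nonneg ha hb hQm hRm hQ hR hu.1
  have h3 : S.mpcForm N θ' x v 0 (u - v) = - S.mpcForm N θ' x v 0 (v - u) := by
    have := S.mpcForm_smul_right hQ hR N θ' x 0 (-1) v (v - u)
    simpa using this
  have h4 := S.mpcForm_sub_left N θ x x 0 v u (v - u)
  rw [sub_self, S.mpcForm_self hb hRm] at h4
  have h5 := S.mpcForm_sub_mpcForm_le hLx hL hd hQL hA hB hA' hB' hΔA hΔB N x 0 v (v - u)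
  have h6 : b / 2 * ∑ i ∈ range N, ‖(v - u) i‖ ^ 2 ≤ S.mpcCost N θ 0 (v - u) := by
    rw [mul_sum]
    exact (sum_le_sum fun i _ => hRm _).trans (S.sum_costU_le_mpcCost ha hb hQm hRm N θ 0 (v - u))
  have h7 := sq_sum_le_card_mul_sum_sq (s := range N) (f := fun i => ‖(v - u) i‖)
  rw [card_range] at h7
  have hkD : ‖u k - v k‖ ≤ ∑ i ∈ range N, ‖(v - u) i‖ := by
    rw [norm_sub_rev]
    exact single_le_sum (f := fun i => ‖(v - u) i‖) (fun _ _ => norm_nonneg _) (mem_range.2 hk)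
  set D := ∑ i ∈ range N, ‖(v - u) i‖ with hD
  have hD0 : 0 ≤ D := by positivity
  rw [norm_zero, zero_add] at h5
  set s := ‖x‖ + ∑ i ∈ range N, ‖v i‖ with hs'
  have hs1 : s ≤ (1 + N * C) * ‖x‖ := by linarith
  have h8 : b / 2 * D ^ 2 ≤ (N * (K * d * s)) * D := by
    calc _ ≤ b / 2 * (N * ∑ i ∈ range N, ‖(v - u) i‖ ^ 2) := by gcongr
      _ = N * (b / 2 * ∑ i ∈ range N, ‖(v - u) i‖ ^ 2) := by ring
      _ ≤ N * (K * d * s * D) := by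
        refine mul_le_mul_of_nonneg_left (h6.trans ?_) (by positivity)
        have : (N + 1) * (Lx * (N * L ^ N * d) * L ^ N) = K * d := by simp only [K]; ring
        rw [this] at h5
        linarith
      _ = _ := by ring
  have h9 : D ≤ 2 / b * (N * (K * d * s)) := by
    rcases hD0.eq_or_lt with h | h
    · rw [← h]; positivity
    · have : b / 2 * D ≤ N * (K * d * s) := by nlinarith
      calc D = 2 / b * (b / 2 * D) := by field_simp
        _ ≤ _ := by gcongr
  calc _ ≤ _ := hkD.trans h9
    _ ≤ 2 / b * (N * (K * d * ((1 + N * C) * ‖x‖))) := by gcongr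
    _ = _ := by ring

theorem exists_sensitivity_constants {Lx L LΔ δ a b : ℝ} (ha : 0 < a) (hb : 0 < b)
    (hQm : ∀ x, a / 2 * ‖x‖ ^ 2 ≤ S.costX x) (hRm : ∀ u, b / 2 * ‖u‖ ^ 2 ≤ S.costU u)
    (hQ : S.Q.IsHermitian) (hR : S.R.IsHermitian)
    (hQL : ∀ x, ‖(2 : ℝ) • Matrix.toEuclideanLin S.Q x‖ ≤ Lx * ‖x‖) (hLx : 0 < Lx)
    (θhat : EuclideanSpace ℝ (Fin p)) (Θ : Set (EuclideanSpace ℝ (Fin p)))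
    (hΘ : ∀ θ ∈ Θ, ‖θ - θhat‖ ≤ δ) (hL : 1 ≤ L) (hLΔ : 0 ≤ LΔ)
    (hA : ∀ x, ‖Matrix.toEuclideanLin (S.A θhat) x‖ ≤ L * ‖x‖)
    (hB : ∀ u, ‖Matrix.toEuclideanLin (S.B θhat) u‖ ≤ L * ‖u‖)
    (hΔA : ∀ θ ∈ Θ, ∀ x, ‖Matrix.toEuclideanLin (S.A θ - S.A θhat) x‖
      ≤ LΔ * ‖θ - θhat‖ * ‖x‖)
    (hΔB : ∀ θ ∈ Θ, ∀ u, ‖Matrix.toEuclideanLin (S.B θ - S.B θhat) u‖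
      ≤ LΔ * ‖θ - θhat‖ * ‖u‖) (N : ℕ) :
    ∃ C ρ ω : ℝ, 0 < C ∧ 0 < ρ ∧ ρ < 1 ∧ 0 ≤ ω ∧
      S.StateSensitivity N θhat Set.univ C ρ ∧ S.ParamSensitivity N θhat Θ Set.univ ω := by
  set C := √((N + 1) * (Lx / b) * (L ^ N) ^ 2)
  -- A Lipschitz constant uniform over Θ. The absolute value covers an empty Θ, for which δ may be
  -- negative.
  set L' := L + LΔ * |δ|
  have hLL' : L ≤ L' := by simp only [L', le_add_iff_nonneg_right]; positivity
  set ω := 2 / b * N * ((N + 1) * (Lx * (N * L' ^ N) * L' ^ N)) *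
        (1 + N * √((N + 1) * (Lx / b) * (L' ^ N) ^ 2)) with hω
  have hL' : 1 ≤ L' := hL.trans hLL'
  -- The rate 1/2 is arbitrary: 2^N pays for the decay over k < N, and the summand 1 makes the
  -- constant positive.
  refine ⟨2 ^ N * C + 1, 1 / 2, ω * LΔ, by positivity, by norm_num, by norm_num, by positivity,
    fun x _ y _ k hk => ?_, fun θ hθ x _ k hk => ?_⟩
  · refine (S.norm_mpcInput_sub_le ha hb hQm hRm hQ hR hQL hLx hL hA hB N x y hk).trans ?_
    gcongr
    have h1 : (1 : ℝ) ≤ 2 ^ N * (1 / 2) ^ k := by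
      rw [one_div_pow, ← div_eq_mul_one_div, one_le_div (by positivity)]
      exact pow_le_pow_right₀ (by norm_num) hk.le
    calc C ≤ C * (2 ^ N * (1 / 2) ^ k) := le_mul_of_one_le_right (Real.sqrt_nonneg _) h1
      _ ≤ C * (2 ^ N * (1 / 2) ^ k) + (1 / 2) ^ k := by
        rw [le_add_iff_nonneg_right]; positivity
      _ = _ := by ring
  · have hbd : ∀ {j : ℕ} (T T' : Matrix (Fin n) (Fin j) ℝ),
        (∀ x, ‖Matrix.toEuclideanLin T' x‖ ≤ L * ‖x‖) →
        (∀ x, ‖Matrix.toEuclideanLin (T - T') x‖ ≤ LΔ * ‖θ - θhat‖ * ‖x‖) →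
        ∀ x, ‖Matrix.toEuclideanLin T x‖ ≤ L' * ‖x‖ := by
      intro j T T' h h' x
      have e : Matrix.toEuclideanLin T x =
          Matrix.toEuclideanLin T' x + Matrix.toEuclideanLin (T - T') x := by
        simp [map_sub]
      rw [e]
      refine (norm_add_le _ _).trans ((add_le_add (h x) (h' x)).trans ?_)
      rw [← add_mul]
      have := (hΘ θ hθ).trans (le_abs_self δ)
      simp only [L']
      gcongr
    have h := S.norm_mpcInput_sub_mpcInput_le ha hb hQm hRm hQ hR hLx hL'
      (mul_nonneg hLΔ (norm_nonneg (θ - θhat))) hQL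
      (hbd _ _ hA (hΔA θ hθ)) (hbd _ _ hB (hΔB θ hθ)) (fun x => (hA x).trans (by gcongr))
      (fun x => (hB x).trans (by gcongr)) (hΔA θ hθ) (hΔB θ hθ) N x hk
    rw [← hω, ← mul_assoc] at h
    exact h

end LQSystem

/-! ### Decrease of the value function without mismatch -/

/-- Here W is the value at the successor, a_k are the stage costs of the shifted old prediction and
b is its terminal cost. The remainder s_j = W - ∑_{k<j} a_k satisfies s_{j+1} ≤ s_j γ/(1+γ) with γ =
γ_{n+1-j}, so it contracts by a product of such factors before the relaxed Lyapunov inequality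
closes the last step. -/
theorem relaxed_excess_le {n : ℕ} {κ W b : ℝ} {γ a : ℕ → ℝ} (hκ : 0 ≤ κ)
    (hγ : ∀ i, 1 ≤ i → 0 < γ i)
    (h : ∀ j < n, W - ∑ k ∈ range j, a k ≤ (1 + γ (n + 1 - j)) * a j)
    (hb : W - ∑ k ∈ range n, a k ≤ (1 + κ) * b) :
    ((1 + κ) * ∏ i ∈ Icc 2 (n + 1), (1 + γ i) - κ * ∏ i ∈ Icc 2 (n + 1), γ i) *
        (W - (∑ k ∈ range n, a k + b)) ≤
      κ * (∏ i ∈ Icc 2 (n + 1), γ i) * (∑ k ∈ range n, a k + b) := by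
  have hre : ∀ f : ℕ → ℝ, ∏ i ∈ range n, f (n + 1 - i) = ∏ i ∈ Icc 2 (n + 1), f i := fun f =>
    prod_bij' (fun i _ => n + 1 - i) (fun i _ => n + 1 - i)
      (fun i hi => by simp only [mem_range, mem_Icc] at *; omega)
      (fun i hi => by simp only [mem_range, mem_Icc] at *; omega)
      (fun i hi => by simp only [mem_range] at *; omega)
      (fun i hi => by simp only [mem_Icc] at *; omega) (fun _ _ => rfl)
  have key : ∀ j ≤ n, (W - ∑ k ∈ range j, a k) * ∏ i ∈ range j, (1 + γ (n + 1 - i)) ≤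
      W * ∏ i ∈ range j, γ (n + 1 - i) := by
    intro j hj
    induction j with
    | zero => simp
    | succ j ih =>
      have h1 := ih (by omega)
      have h2 := h j (by omega)
      have h3 := hγ (n + 1 - j) (by omega)
      have h4 : 0 ≤ ∏ i ∈ range j, (1 + γ (n + 1 - i)) := prod_nonneg fun i hi => by
        have := hγ (n + 1 - i) (by rw [mem_range] at hi; omega)
        linarith
      rw [sum_range_succ, prod_range_succ, prod_range_succ]
      set s := W - ∑ k ∈ range j, a k
      set g := γ (n + 1 - j)
      have h5 : (s - a j) * (1 + g) ≤ s * g := by linarith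
      calc _ = (s - a j) * (1 + g) * ∏ i ∈ range j, (1 + γ (n + 1 - i)) := by simp only [s]; ring
        _ ≤ s * g * ∏ i ∈ range j, (1 + γ (n + 1 - i)) := by gcongr
        _ = s * (∏ i ∈ range j, (1 + γ (n + 1 - i))) * g := by ring
        _ ≤ W * (∏ i ∈ range j, γ (n + 1 - i)) * g := by gcongr
        _ = _ := by ring
  have h1 := key n le_rfl
  rw [hre γ, hre fun i => 1 + γ i] at h1
  have h2 : 0 ≤ ∏ i ∈ Icc 2 (n + 1), (1 + γ i) := prod_nonneg fun i hi => by
    have := hγ i (by rw [mem_Icc] at hi; omega)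
    linarith
  set G := ∏ i ∈ Icc 2 (n + 1), γ i
  set H := ∏ i ∈ Icc 2 (n + 1), (1 + γ i)
  set s := ∑ k ∈ range n, a k
  have h3 : (1 + κ) * (W - (s + b)) ≤ κ * (W - s) := by linarith
  have h4 := mul_le_mul_of_nonneg_right h3 h2
  have h5 := mul_le_mul_of_nonneg_left h1 hκ
  linarith

namespace LQConstants

variable (c : LQConstants)

theorem eps_denom_pos (hκ : 0 ≤ c.κ) (hγ : ∀ i, 1 ≤ i → 0 < c.γ i) (N : ℕ) :
    0 < (1 + c.κ) * (∏ i ∈ Icc 2 N, (1 + c.γ i)) - c.κ * ∏ i ∈ Icc 2 N, c.γ i := by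
  have hγ' : ∀ i ∈ Icc 2 N, 0 < c.γ i := fun i hi => hγ i (by rw [mem_Icc] at hi; omega)
  have h1 : ∏ i ∈ Icc 2 N, c.γ i ≤ ∏ i ∈ Icc 2 N, (1 + c.γ i) :=
    prod_le_prod (fun i hi => (hγ' i hi).le) fun i _ => by linarith
  have h2 : 0 < ∏ i ∈ Icc 2 N, c.γ i := prod_pos hγ'
  nlinarith

theorem eps_nonneg (hκ : 0 ≤ c.κ) (hγ : ∀ i, 1 ≤ i → 0 < c.γ i) {N : ℕ} (hN : 1 ≤ N) :
    0 ≤ c.eps N := by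
  have h1 := c.eps_denom_pos hκ hγ N
  have h2 : 0 < ∏ i ∈ Icc 2 N, c.γ i :=
    prod_pos fun i hi => hγ i (by rw [mem_Icc] at hi; omega)
  have h3 := hγ N hN
  exact div_nonneg (by positivity) h1.le

end LQConstants

namespace LQSystem

variable {n m p r : ℕ} (S : LQSystem n m p r)

theorem mpcCost_add (j i : ℕ) (θ x) (u : ℕ → EuclideanSpace ℝ (Fin m)) :
    S.mpcCost (j + i) θ x u = (∑ k ∈ range j, S.cost (S.rollout θ x u k) (u k)) +
      S.mpcCost i θ (S.rollout θ x u j) (fun k => u (j + k)) := by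
  simp only [mpcCost, sum_range_add, rollout_shift]
  ring

/-- Dynamic programming: follow u for j steps, then re-optimise over the remaining horizon i. -/
theorem mpcValue_add_le {a b : ℝ} (ha : 0 < a) (hb : 0 < b)
    (hQm : ∀ x, a / 2 * ‖x‖ ^ 2 ≤ S.costX x) (hRm : ∀ u, b / 2 * ‖u‖ ^ 2 ≤ S.costU u)
    (j i : ℕ) (θ x) {u : ℕ → EuclideanSpace ℝ (Fin m)} (hu : u ∈ S.admissible) :
    S.mpcValue (j + i) θ x ≤ (∑ k ∈ range j, S.cost (S.rollout θ x u k) (u k)) +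
      S.mpcValue i θ (S.rollout θ x u j) := by
  set v := S.mpcInput i θ (S.rollout θ x u j)
  have hv : v ∈ S.admissible :=
    (S.isMPCSolution_mpcInput ha hb hQm hRm i θ (S.rollout θ x u j)).1
  set w : ℕ → EuclideanSpace ℝ (Fin m) := fun k => if k < j then u k else v (k - j)
  have hw : w ∈ S.admissible := fun k => by
    by_cases hk : k < j
    · simpa only [w, hk, if_true] using hu k
    · simpa only [w, hk, if_false] using hv (k - j)
  have hwu : ∀ k < j, w k = u k := fun k hk => if_pos hk
  have hr : ∀ k ≤ j, S.rollout θ x w k = S.rollout θ x u k := fun k hk =>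
    S.rollout_congr θ x fun i hi => hwu i (by omega)
  refine (S.mpcValue_le ha hb hQm hRm _ θ x hw).trans_eq ?_
  rw [mpcCost_add, S.mpcValue_eq ha hb hQm hRm, hr j le_rfl]
  congr 1
  · refine sum_congr rfl fun k hk => ?_
    rw [mem_range] at hk
    rw [hr k hk.le, hwu k hk]
  · refine S.mpcCost_congr _ _ fun k _ => ?_
    simp [w, v]

/-- Without model mismatch, the value function decreases along the MPC closed loop. -/
theorem mpcValue_step_le (c : LQConstants)
    (hmx : 0 < c.mx) (hmu : 0 < c.mu)
    (hQm : ∀ x, c.mx / 2 * ‖x‖ ^ 2 ≤ S.costX x) (hRm : ∀ u, c.mu / 2 * ‖u‖ ^ 2 ≤ S.costU u)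
    (θhat : EuclideanSpace ℝ (Fin p)) (X : Set (EuclideanSpace ℝ (Fin n))) (hκ : 0 ≤ c.κ)
    (hclf : ∀ x ∈ X, ∃ u ∈ S.inputSet,
      S.costX (S.step θhat x u) + S.cost x u ≤ (1 + c.κ) * S.costX x)
    (hγ : ∀ i, 1 ≤ i → 0 < c.γ i)
    (hctrl : ∀ x ∈ X, ∀ i, 1 ≤ i → S.mpcValue i θhat x ≤ (1 + c.γ i) * S.costStar x)
    {N : ℕ} (hN : 1 ≤ N) {x : EuclideanSpace ℝ (Fin n)}
    (hX : ∀ k ≤ N, S.rollout θhat x (S.mpcInput N θhat x) k ∈ X) :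
    S.mpcValue N θhat (S.step θhat x (S.policy N θhat x)) ≤
      S.mpcValue N θhat x - (1 - c.eps N) * S.cost x (S.policy N θhat x) := by
  obtain ⟨q, rfl⟩ := Nat.exists_eq_add_of_le hN
  set N := 1 + q with hNdef
  set u := S.mpcInput N θhat x with hu
  have hua : u ∈ S.admissible := (S.isMPCSolution_mpcInput hmx hmu hQm hRm N θhat x).1
  set y := S.rollout θhat x u 1 with hy
  have hstep : S.step θhat x (S.policy N θhat x) = y := rfl
  set W := S.mpcValue N θhat y with hW
  set v : ℕ → EuclideanSpace ℝ (Fin m) := fun k => u (1 + k) with hv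
  have hva : v ∈ S.admissible := fun k => hua _
  set a : ℕ → ℝ := fun k => S.cost (S.rollout θhat y v k) (v k) with ha
  set b := S.costX (S.rollout θhat y v q) with hb
  have hyX : ∀ k ≤ q, S.rollout θhat y v k ∈ X := fun k hk => by
    rw [hy, hv, ← rollout_shift]; exact hX _ (by omega)
  have hctrl' : ∀ z ∈ X, ∀ i, 1 ≤ i → S.mpcValue i θhat z ≤ (1 + c.γ i) * S.costX z := by
    intro z hz i hi
    rw [← S.costStar_eq hmu hRm]; exact hctrl z hz i hi
  have hcost : ∀ z w, S.costX z ≤ S.cost z w := fun z w => by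
    have := S.costU_nonneg hmu hRm w
    simp only [cost]; linarith
  -- Follow the shifted inputs for j steps, then invoke controllability with the remaining horizon N
  -- - j.
  have h1 : ∀ j < q, W - ∑ k ∈ range j, a k ≤ (1 + c.γ (q + 1 - j)) * a j := by
    intro j hj
    have e : N = j + (q + 1 - j) := by omega
    have h2 := S.mpcValue_add_le hmx hmu hQm hRm j (q + 1 - j) θhat y hva
    rw [← e] at h2
    have h3 := hctrl' _ (hyX j hj.le) (q + 1 - j) (by omega)
    have h4 : (1 + c.γ (q + 1 - j)) * S.costX (S.rollout θhat y v j) ≤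
        (1 + c.γ (q + 1 - j)) * a j := by
      have := hγ (q + 1 - j) (by omega)
      exact mul_le_mul_of_nonneg_left (hcost _ _) (by linarith)
    linarith
  -- With one step left, the input from the Lyapunov condition is a competitor for the horizon-1
  -- problem.
  have h2 : W - ∑ k ∈ range q, a k ≤ (1 + c.κ) * b := by
    have e : N = q + 1 := by omega
    have h3 := S.mpcValue_add_le hmx hmu hQm hRm q 1 θhat y hva
    rw [← e] at h3
    obtain ⟨w, hw, hw'⟩ := hclf _ (hyX q le_rfl)
    have h4 := S.mpcValue_le hmx hmu hQm hRm 1 θhat (S.rollout θhat y v q)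
      (u := fun _ => w) (fun _ => hw)
    have h5 : S.mpcCost 1 θhat (S.rollout θhat y v q) (fun _ => w) =
        S.costX (S.step θhat (S.rollout θhat y v q) w) + S.cost (S.rollout θhat y v q) w := by
      simp only [mpcCost, S.costStar_eq hmu hRm, sum_range_one, rollout_succ, rollout_zero]
      ring
    linarith
  have h3 := relaxed_excess_le hκ hγ h1 h2
  have hV : S.mpcValue N θhat x = S.cost x (S.policy N θhat x) + (∑ k ∈ range q, a k + b) := by
    rw [S.mpcValue_eq hmx hmu hQm hRm, hNdef, mpcCost_add, sum_range_one]
    congr 1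
    rw [mpcCost, S.costStar_eq hmu hRm]
  have h4 := hctrl' x (hX 0 (by omega)) N (by omega)
  -- Controllability at x with horizon N bounds the tail of the prediction by its first stage cost;
  -- this is the factor γ_N in ε_N.
  have h5 : ∑ k ∈ range q, a k + b ≤ c.γ N * S.cost x (S.policy N θhat x) := by
    have := hγ N (by omega)
    have h6 : (1 + c.γ N) * S.costX x ≤ (1 + c.γ N) * S.cost x (S.policy N θhat x) :=
      mul_le_mul_of_nonneg_left (hcost _ _) (by linarith)
    linarith
  have hden := c.eps_denom_pos hκ hγ N
  have hG : 0 < ∏ i ∈ Icc 2 N, c.γ i := prod_pos fun i hi => hγ i (by rw [mem_Icc] at hi; omega)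
  have e : q + 1 = N := by omega
  rw [e] at h3
  have h7 : W - (∑ k ∈ range q, a k + b) ≤ c.eps N * S.cost x (S.policy N θhat x) := by
    rw [LQConstants.eps, div_mul_eq_mul_div, le_div_iff₀ hden]
    have h8 := mul_le_mul_of_nonneg_left h5 (mul_nonneg hκ hG.le)
    linarith
  rw [hstep, hV]
  linarith

end LQSystem

/-! ### Perturbation of the state and the bound α⋆ -/

/-- Discrete Grönwall inequality; it controls the deviation of two rollouts. -/
theorem le_pow_mul_add_sum {L : ℝ} (hL : 0 ≤ L) {a b : ℕ → ℝ} {k : ℕ}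
    (h : ∀ i < k, a (i + 1) ≤ L * a i + b i) :
    a k ≤ L ^ k * a 0 + ∑ i ∈ range k, L ^ (k - 1 - i) * b i := by
  induction k with
  | zero => simp
  | succ k ih =>
    have h1 := mul_le_mul_of_nonneg_left (ih fun i hi => h i (by omega)) hL
    have h2 : ∑ i ∈ range k, L ^ (k + 1 - 1 - i) * b i =
        L * ∑ i ∈ range k, L ^ (k - 1 - i) * b i := by
      rw [mul_sum]
      refine sum_congr rfl fun i hi => ?_
      rw [mem_range] at hi
      rw [show k + 1 - 1 - i = (k - 1 - i) + 1 by omega]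
      ring
    rw [sum_range_succ, h2]
    have h3 := h k (by omega)
    simp only [add_tsub_cancel_right, tsub_self, pow_zero, one_mul]
    rw [pow_succ]
    linarith

/-- Cauchy–Schwarz in two dimensions: after squaring, the cross term is AM–GM applied to ah and bg.
-/
theorem add_sq_le_add_mul_add {A B a b g h : ℝ} (ha : 0 ≤ a) (hb : 0 ≤ b) (hg : 0 ≤ g)
    (hh : 0 ≤ h) (hA : A ^ 2 ≤ a * g) (hB : B ^ 2 ≤ b * h) :
    (A + B) ^ 2 ≤ (a + b) * (g + h) := by
  have h1 : 2 * (A * B) ≤ a * h + b * g := by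
    refine le_of_abs_le (sq_le_sq.1 ?_ |>.trans_eq (abs_of_nonneg (by positivity)))
    have h2 := mul_le_mul hA hB (sq_nonneg B) (mul_nonneg ha hg)
    nlinarith [sq_nonneg (a * h - b * g)]
  nlinarith

namespace LQSystem

variable {n m p r : ℕ} (S : LQSystem n m p r)

theorem inner_add_toEuclideanLin_le {k : ℕ} {Q : Matrix (Fin k) (Fin k) ℝ} (hQ : Q.IsHermitian)
    {L : ℝ} (hQL : ∀ x, ‖(2 : ℝ) • Matrix.toEuclideanLin Q x‖ ≤ L * ‖x‖)
    (x e : EuclideanSpace ℝ (Fin k)) :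
    inner ℝ (x + e) (Matrix.toEuclideanLin Q (x + e)) ≤
      inner ℝ x (Matrix.toEuclideanLin Q x) + L * (‖x‖ * ‖e‖) + L / 2 * ‖e‖ ^ 2 := by
  have h1 := real_inner_le_norm e ((2 : ℝ) • Matrix.toEuclideanLin Q x)
  have h2 := real_inner_le_norm e ((2 : ℝ) • Matrix.toEuclideanLin Q e)
  rw [real_inner_smul_right] at h1 h2
  have h3 := mul_le_mul_of_nonneg_left (hQL x) (norm_nonneg e)
  have h4 := mul_le_mul_of_nonneg_left (hQL e) (norm_nonneg e)
  rw [map_add, inner_add_left, inner_add_right, inner_add_right, inner_toEuclideanLin_comm hQ x e]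
  linarith

theorem costX_add_le (hQ : S.Q.IsHermitian) {L : ℝ} (hL : 0 ≤ L)
    (hQL : ∀ x, ‖(2 : ℝ) • Matrix.toEuclideanLin S.Q x‖ ≤ L * ‖x‖) {x e} {d : ℝ}
    (he : ‖e‖ ≤ d) :
    S.costX (x + e) ≤ S.costX x + L * (‖x‖ * d) + L / 2 * d ^ 2 :=
  (inner_add_toEuclideanLin_le hQ hQL x e).trans (by unfold costX; gcongr)

theorem costU_add_le (hR : S.R.IsHermitian) {L : ℝ} (hL : 0 ≤ L)
    (hRL : ∀ u, ‖(2 : ℝ) • Matrix.toEuclideanLin S.R u‖ ≤ L * ‖u‖) {u e} {d : ℝ}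
    (he : ‖e‖ ≤ d) :
    S.costU (u + e) ≤ S.costU u + L * (‖u‖ * d) + L / 2 * d ^ 2 :=
  (inner_add_toEuclideanLin_le hR hRL u e).trans (by unfold costU; gcongr)

/-- Cauchy–Schwarz, with norms traded for costs by coercivity. It turns first-order terms of the
expansion into square roots of value functions. -/
theorem sum_norm_mul_sq_le {ι E : Type*} [NormedAddCommGroup E] {f : E → ℝ} {a : ℝ} (ha : 0 < a)
    (hf : ∀ x, a / 2 * ‖x‖ ^ 2 ≤ f x) (s : Finset ι) (ξ : ι → E) (g : ι → ℝ) :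
    (∑ k ∈ s, ‖ξ k‖ * g k) ^ 2 ≤ 2 / a * (∑ k ∈ s, f (ξ k)) * ∑ k ∈ s, g k ^ 2 := by
  refine (sum_mul_sq_le_sq_mul_sq s _ g).trans ?_
  refine mul_le_mul_of_nonneg_right ?_ (sum_nonneg fun _ _ => sq_nonneg _)
  rw [mul_sum]
  refine sum_le_sum fun k _ => ?_
  calc ‖ξ k‖ ^ 2 = 2 / a * (a / 2 * ‖ξ k‖ ^ 2) := by field_simp
    _ ≤ _ := by gcongr; exact hf _

theorem sum_pow_two_mul_le {ρ : ℝ} (h0 : 0 < ρ) (h1 : ρ < 1) (N : ℕ) :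
    ∑ k ∈ range N, (ρ ^ k) ^ 2 ≤ 1 / (1 - ρ ^ 2) := by
  have h2 : ρ ^ 2 < 1 := pow_lt_one₀ h0.le h1 two_ne_zero
  have h3 : ∀ k, (ρ ^ k) ^ 2 = (ρ ^ 2) ^ k := fun k => by rw [← pow_mul, ← pow_mul, mul_comm]
  simp only [h3]
  rw [one_div, ← tsum_geometric_of_lt_one (sq_nonneg ρ) h2]
  exact (summable_geometric_of_lt_one (sq_nonneg ρ) h2).sum_le_tsum _ fun _ _ => by positivity

/-- The value function at a perturbed state. -/
theorem mpcValue_le_add_alphaStar (c : LQConstants)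
    (hQ : S.Q.IsHermitian) (hR : S.R.IsHermitian)
    (hmx : 0 < c.mx) (hLx : 0 < c.Lx) (hmu : 0 < c.mu) (hLu : 0 < c.Lu)
    (hQm : ∀ x, c.mx / 2 * ‖x‖ ^ 2 ≤ S.costX x)
    (hQL : ∀ x, ‖(2 : ℝ) • Matrix.toEuclideanLin S.Q x‖ ≤ c.Lx * ‖x‖)
    (hRm : ∀ u, c.mu / 2 * ‖u‖ ^ 2 ≤ S.costU u)
    (hRL : ∀ u, ‖(2 : ℝ) • Matrix.toEuclideanLin S.R u‖ ≤ c.Lu * ‖u‖)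
    (hLfx0 : 0 ≤ c.Lfx) (hLfu0 : 0 ≤ c.Lfu) {θhat : EuclideanSpace ℝ (Fin p)}
    (hLfx : ∀ x, ‖Matrix.toEuclideanLin (S.A θhat) x‖ ≤ c.Lfx * ‖x‖)
    (hLfu : ∀ u, ‖Matrix.toEuclideanLin (S.B θhat) u‖ ≤ c.Lfu * ‖u‖)
    (hLΔ0 : 0 ≤ c.LΔ) {X : Set (EuclideanSpace ℝ (Fin n))} {N : ℕ} {C ρ δ l : ℝ}
    (hγε : 0 ≤ c.γbar + c.eps N) (hC : 0 < C) (hρ0 : 0 < ρ) (hρ1 : ρ < 1)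
    (hS : S.StateSensitivity N θhat X C ρ) {x y} (hx : x ∈ X) (hy : y ∈ X) (hδ : 0 ≤ δ)
    (hl : 0 ≤ l) (hxy : ‖y - x‖ ^ 2 ≤ c.LΔ ^ 2 * δ ^ 2 * (c.M * l))
    (hV : S.mpcValue N θhat x ≤ (c.γbar + c.eps N) * l) :
    S.mpcValue N θhat y ≤ S.mpcValue N θhat x + c.alphaStar C ρ N δ * l := by
  have hM : 0 < c.M := by unfold LQConstants.M; positivity
  set u := S.mpcInput N θhat x
  set v := S.mpcInput N θhat y
  set ξ := S.rollout θhat x u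
  set η := S.rollout θhat y v
  set d := ‖y - x‖ with hd
  have hw : ∀ k < N, ‖v k - u k‖ ≤ C * ρ ^ k * d := fun k hk => hS y hy x hx k hk
  -- Γ_k collects the initial error propagated through A and the input errors Cρ^i d injected
  -- through B.
  have he : ∀ k ≤ N, ‖η k - ξ k‖ ≤ c.Γ C ρ k * d := by
    intro k hk
    have h1 := le_pow_mul_add_sum hLfx0 (a := fun k => ‖η k - ξ k‖)
      (b := fun k => c.Lfu * (C * ρ ^ k * d)) (k := k) fun i hi => by
        have e : η (i + 1) - ξ (i + 1) = Matrix.toEuclideanLin (S.A θhat) (η i - ξ i) +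
            Matrix.toEuclideanLin (S.B θhat) (v i - u i) := by
          simp only [η, ξ, rollout_succ, step, map_sub]; abel
        simp only [e]
        refine (norm_add_le _ _).trans (add_le_add (hLfx _) ((hLfu _).trans ?_))
        exact mul_le_mul_of_nonneg_left (hw i (by omega)) hLfu0
    refine h1.trans_eq ?_
    rw [LQConstants.Γ, add_mul, mul_sum, sum_mul]
    congr 1
    exact sum_congr rfl fun i _ => by ring
  have hΓ : ∀ k, 0 ≤ c.Γ C ρ k := fun k => by unfold LQConstants.Γ; positivity
  set G := ∑ k ∈ range (N + 1), c.Γ C ρ k ^ 2 with hG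
  have hG0 : 0 ≤ G := sum_nonneg fun _ _ => sq_nonneg _
  have hρ2 : 0 < 1 - ρ ^ 2 := sub_pos.2 (pow_lt_one₀ hρ0.le hρ1 two_ne_zero)
  have hρs := sum_pow_two_mul_le hρ0 hρ1 N
  set VX := ∑ k ∈ range (N + 1), S.costX (ξ k) with hVX
  set VU := ∑ k ∈ range N, S.costU (u k) with hVU
  have hVX0 : 0 ≤ VX := sum_nonneg fun _ _ => S.costX_nonneg hmx hQm _
  have hVU0 : 0 ≤ VU := sum_nonneg fun _ _ => S.costU_nonneg hmu hRm _
  have hVx : S.mpcValue N θhat x = VX + VU := by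
    rw [S.mpcValue_eq hmx hmu hQm hRm, S.mpcCost_eq hmu hRm]
  have hVy : S.mpcValue N θhat y =
      (∑ k ∈ range (N + 1), S.costX (η k)) + ∑ k ∈ range N, S.costU (v k) := by
    rw [S.mpcValue_eq hmx hmu hQm hRm, S.mpcCost_eq hmu hRm]
  set Z1 := ∑ k ∈ range (N + 1), ‖ξ k‖ * c.Γ C ρ k with hZ1
  set Z2 := ∑ k ∈ range N, ‖u k‖ * ρ ^ k with hZ2
  have hX : ∑ k ∈ range (N + 1), S.costX (η k) ≤ VX + c.Lx * Z1 * d + c.Lx / 2 * G * d ^ 2 := by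
    rw [hVX, hZ1, hG, mul_sum, mul_sum, sum_mul, sum_mul, ← sum_add_distrib, ← sum_add_distrib]
    refine sum_le_sum fun k hk => ?_
    have := S.costX_add_le hQ hLx.le hQL (x := ξ k) (he k (mem_range_succ_iff.1 hk))
    rw [add_sub_cancel] at this
    linarith
  have hU : ∑ k ∈ range N, S.costU (v k) ≤
      VU + c.Lu * C * Z2 * d + c.Lu / 2 * C ^ 2 * (∑ k ∈ range N, (ρ ^ k) ^ 2) * d ^ 2 := by
    rw [hVU, hZ2, mul_sum, mul_sum, sum_mul, sum_mul, ← sum_add_distrib, ← sum_add_distrib]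
    refine sum_le_sum fun k hk => ?_
    have := S.costU_add_le hR hLu.le hRL (u := u k) (hw k (mem_range.1 hk))
    rw [add_sub_cancel] at this
    linarith
  have hU' : c.Lu / 2 * C ^ 2 * (∑ k ∈ range N, (ρ ^ k) ^ 2) * d ^ 2 ≤
      c.Lu / 2 * C ^ 2 * (1 / (1 - ρ ^ 2)) * d ^ 2 := by gcongr
  set g1 := c.Lx ^ 2 / c.mx * G with hg1
  set g2 := c.Lu ^ 2 * C ^ 2 / (c.mu * (1 - ρ ^ 2)) with hg2
  have hg10 : 0 ≤ g1 := by positivity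
  have hg20 : 0 ≤ g2 := by positivity
  have hZ1' : (c.Lx * Z1) ^ 2 ≤ VX * (2 * g1) := by
    have h := sum_norm_mul_sq_le hmx hQm (range (N + 1)) ξ (c.Γ C ρ)
    calc (c.Lx * Z1) ^ 2 = c.Lx ^ 2 * Z1 ^ 2 := by ring
      _ ≤ c.Lx ^ 2 * (2 / c.mx * VX * G) := by gcongr
      _ = _ := by rw [hg1]; ring
  have hZ2' : (c.Lu * C * Z2) ^ 2 ≤ VU * (2 * g2) := by
    have h := sum_norm_mul_sq_le hmu hRm (range N) u (fun k => ρ ^ k)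
    calc (c.Lu * C * Z2) ^ 2 = c.Lu ^ 2 * C ^ 2 * Z2 ^ 2 := by ring
      _ ≤ c.Lu ^ 2 * C ^ 2 * (2 / c.mu * VU * (1 / (1 - ρ ^ 2))) := by
        gcongr
        exact h.trans (by gcongr)
      _ = _ := by rw [hg2]; field_simp
  have hZ := add_sq_le_add_mul_add hVX0 hVU0 (by positivity) (by positivity) hZ1' hZ2'
  rw [hVx] at hV
  -- Both V_N(x) and d² are bounded by multiples of l, so the geometric mean is linear in l; its
  -- coefficient is `alpha1`.
  have hlin : (c.Lx * Z1 + c.Lu * C * Z2) * d ≤ c.alpha1 C ρ N * c.LΔ * δ * l := by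
    have h0 : 0 ≤ c.alpha1 C ρ N * c.LΔ * δ * l := by unfold LQConstants.alpha1; positivity
    refine le_of_abs_le (sq_le_sq.1 ?_ |>.trans_eq (abs_of_nonneg h0))
    calc ((c.Lx * Z1 + c.Lu * C * Z2) * d) ^ 2 = (c.Lx * Z1 + c.Lu * C * Z2) ^ 2 * d ^ 2 := by ring
      _ ≤ ((VX + VU) * (2 * g1 + 2 * g2)) * (c.LΔ ^ 2 * δ ^ 2 * (c.M * l)) := by gcongr
      _ ≤ (((c.γbar + c.eps N) * l) * (2 * g1 + 2 * g2)) * (c.LΔ ^ 2 * δ ^ 2 * (c.M * l)) := by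
        gcongr
      _ = (2 * c.M * (c.γbar + c.eps N) * (g1 + g2)) * (c.LΔ * δ * l) ^ 2 := by ring
      _ = c.alpha1 C ρ N ^ 2 * (c.LΔ * δ * l) ^ 2 := by
        rw [LQConstants.alpha1, Real.sq_sqrt (by positivity)]
      _ = _ := by ring
  have hquad : (c.Lx / 2 * G + c.Lu / 2 * C ^ 2 * (1 / (1 - ρ ^ 2))) * d ^ 2 ≤
      c.alpha2 C ρ N * c.LΔ ^ 2 * δ ^ 2 * l := by
    calc _ ≤ (c.Lx / 2 * G + c.Lu / 2 * C ^ 2 * (1 / (1 - ρ ^ 2))) *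
          (c.LΔ ^ 2 * δ ^ 2 * (c.M * l)) := by gcongr
      _ = _ := by rw [LQConstants.alpha2, ← hG]; field_simp
  rw [hVx, hVy, LQConstants.alphaStar]
  linarith

end LQSystem

/-! ### Perturbation of the model and comparison with the oracle -/

/-- Combines a perturbation bound `W ≤ V + L F + L/2 E` with an a priori bound `W ≤ (1 + γ) l`. -/
theorem le_add_sqrt_mul_of_perturbation {a L γ h V W l E F : ℝ} (ha : 0 < a) (haL : a ≤ L)
    (hγ : 0 ≤ γ) (hh : 0 ≤ h) (hl : 0 < l) (hlV : l ≤ V) (hVW : V ≤ W) (hWl : W ≤ (1 + γ) * l)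
    (hW : W ≤ V + L * F + L / 2 * E) (hF : F ^ 2 ≤ 2 / a * (V - l) * E)
    (hE : E ≤ h ^ 2 * (a / 2) * V) : W ≤ V + √γ * (L * h) * V := by
  have hV : 0 < V := hl.trans_le hlV
  have hL : 0 < L := ha.trans_le haL
  -- s² is the share of V not incurred at the initial state. The expansion gives W - V ≤ (w²/4 +
  -- ws)V with w = Lh, and the a priori bound gives W - V ≤ (g² - s²)V with g = √γ.
  set s := √((V - l) / V) with hs
  have hs0 : 0 ≤ s := Real.sqrt_nonneg _
  have hs2 : s ^ 2 * V = V - l := by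
    rw [hs, Real.sq_sqrt (div_nonneg (by linarith) hV.le)]; field_simp
  set g := √γ with hg
  have hg0 : 0 ≤ g := Real.sqrt_nonneg _
  have hg2 : g ^ 2 = γ := Real.sq_sqrt hγ
  have hsg : s ≤ g := by
    refine Real.sqrt_le_sqrt ((div_le_iff₀ hV).2 ?_)
    nlinarith
  have hF' : F ≤ h * s * V := by
    refine le_of_abs_le (sq_le_sq.1 ?_ |>.trans_eq (abs_of_nonneg (by positivity)))
    calc F ^ 2 ≤ 2 / a * (V - l) * (h ^ 2 * (a / 2) * V) :=
          hF.trans (mul_le_mul_of_nonneg_left hE (mul_nonneg (by positivity) (by linarith)))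
      _ = h ^ 2 * (V - l) * V := by field_simp
      _ = (h * s * V) ^ 2 := by rw [← hs2]; ring
  have hE' : L / 2 * E ≤ (L * h) ^ 2 / 4 * V := by
    calc L / 2 * E ≤ L / 2 * (h ^ 2 * (L / 2) * V) := by
          refine mul_le_mul_of_nonneg_left (hE.trans ?_) (by positivity)
          gcongr
      _ = _ := by ring
  have hF'' := mul_le_mul_of_nonneg_left hF' hL.le
  set w := L * h with hw
  have hw0 : 0 ≤ w := by positivity
  -- If w/4 ≤ g - s the first bound is at most gwV. Otherwise g² - s² = (g-s)(g+s) ≤ (w/4)(2g), and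
  -- the second bound is.
  by_cases hc : w / 4 ≤ g - s
  · have : (w ^ 2 / 4 + w * s) * V ≤ g * w * V := by
      refine mul_le_mul_of_nonneg_right ?_ hV.le
      nlinarith
    have e : L * (h * s * V) = w * s * V := by rw [hw]; ring
    linarith
  · push Not at hc
    have h1 : W - V ≤ (g ^ 2 - s ^ 2) * V := by
      rw [sub_mul, hs2, hg2]
      nlinarith
    have h2 : g ^ 2 - s ^ 2 ≤ g * w := by nlinarith
    have h3 := mul_le_mul_of_nonneg_right h2 hV.le
    linarith

theorem sum_Icc_one_eq_sum_range (f : ℕ → ℝ) (N : ℕ) :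
    ∑ k ∈ Icc 1 N, f k = ∑ k ∈ range N, f (k + 1) := by
  induction N with
  | zero => simp
  | succ N ih => rw [sum_Icc_succ_top (by omega), ih, sum_range_succ]

namespace LQSystem

variable {n m p r : ℕ} (S : LQSystem n m p r)

/-- Error matching: the one-step model error scales with ‖x‖ + ‖u‖, hence its square with the stage
cost. -/
theorem sq_norm_add_norm_le (c : LQConstants) (hmx : 0 < c.mx) (hmu : 0 < c.mu)
    (hQm : ∀ x, c.mx / 2 * ‖x‖ ^ 2 ≤ S.costX x) (hRm : ∀ u, c.mu / 2 * ‖u‖ ^ 2 ≤ S.costU u)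
    (x u) : (‖x‖ + ‖u‖) ^ 2 ≤ c.M * S.cost x u := by
  have h1 : ‖x‖ ^ 2 ≤ S.costX x * (2 / c.mx) := by
    have := hQm x
    rw [← mul_div_assoc, le_div_iff₀ hmx]; linarith
  have h2 : ‖u‖ ^ 2 ≤ S.costU u * (2 / c.mu) := by
    have := hRm u
    rw [← mul_div_assoc, le_div_iff₀ hmu]; linarith
  refine (add_sq_le_add_mul_add (S.costX_nonneg hmx hQm x) (S.costU_nonneg hmu hRm u)
    (by positivity) (by positivity) h1 h2).trans_eq ?_
  rw [LQConstants.M, cost]; ring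

theorem mx_le_Lx {a L : ℝ} (hQm : ∀ x, a / 2 * ‖x‖ ^ 2 ≤ S.costX x)
    (hQL : ∀ x, ‖(2 : ℝ) • Matrix.toEuclideanLin S.Q x‖ ≤ L * ‖x‖)
    {x : EuclideanSpace ℝ (Fin n)} (hx : x ≠ 0) : a ≤ L := by
  have h := (hQm x).trans (S.costX_le hQL x)
  have h2 : 0 < ‖x‖ ^ 2 := by positivity
  have := le_of_mul_le_mul_right h h2
  linarith

/-- The effect of the model mismatch on the value function. -/
theorem mpcValue_le_mpcValue_add (c : LQConstants) (hQ : S.Q.IsHermitian)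
    (hmx : 0 < c.mx) (hLx : 0 < c.Lx) (hmu : 0 < c.mu)
    (hQm : ∀ x, c.mx / 2 * ‖x‖ ^ 2 ≤ S.costX x)
    (hQL : ∀ x, ‖(2 : ℝ) • Matrix.toEuclideanLin S.Q x‖ ≤ c.Lx * ‖x‖)
    (hRm : ∀ u, c.mu / 2 * ‖u‖ ^ 2 ≤ S.costU u)
    (hLfx0 : 0 ≤ c.Lfx) {θhat θ : EuclideanSpace ℝ (Fin p)}
    (hLfx : ∀ x, ‖Matrix.toEuclideanLin (S.A θhat) x‖ ≤ c.Lfx * ‖x‖) {z : ℝ} (hz : 0 ≤ z)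
    (hΔA : ∀ x, ‖Matrix.toEuclideanLin (S.A θ - S.A θhat) x‖ ≤ z * ‖x‖)
    (hΔB : ∀ u, ‖Matrix.toEuclideanLin (S.B θ - S.B θhat) u‖ ≤ z * ‖u‖)
    (hγ : 0 ≤ c.γbar) {N : ℕ} {x} (hx : S.mpcValue N θhat x ≤ (1 + c.γbar) * S.costX x) :
    S.mpcValue N θhat x ≤ S.mpcValue N θ x +
      √(2 * c.M * c.P N * c.γbar / c.mx) * c.Lx * z * S.mpcValue N θ x := by
  have hM : 0 < c.M := by unfold LQConstants.M; positivity
  set u := S.mpcInput N θ x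
  set ξ := S.rollout θ x u with hξ
  set η := S.rollout θhat x u with hη
  have hua : u ∈ S.admissible := (S.isMPCSolution_mpcInput hmx hmu hQm hRm N θ x).1
  have hV : S.mpcValue N θ x = S.mpcCost N θ x u := S.mpcValue_eq hmx hmu hQm hRm N θ x
  have hV0 : 0 ≤ S.mpcValue N θ x := hV ▸ S.mpcCost_nonneg hmx hmu hQm hRm N θ x u
  have hP : ∑ k ∈ range N, ∑ i ∈ range (k + 1), c.Lfx ^ (2 * i) ≤ c.P N := by
    rw [LQConstants.P, ← sum_Icc_one_eq_sum_range (fun k => ∑ i ∈ range k, c.Lfx ^ (2 * i)),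
      le_add_iff_nonneg_left]
    exact sum_nonneg fun _ _ => by positivity
  have hP0 : 0 ≤ c.P N := (sum_nonneg fun _ _ => sum_nonneg fun _ _ => by positivity).trans hP
  have hrhs : 0 ≤ √(2 * c.M * c.P N * c.γbar / c.mx) * c.Lx * z * S.mpcValue N θ x := by positivity
  rcases le_total (S.mpcValue N θhat x) (S.mpcValue N θ x) with hle | hle
  · linarith
  -- The scalar lemma needs ℓ_x(x) > 0 and m_x ≤ L_x; both use a nonzero state.
  rcases eq_or_ne x 0 with rfl | hx0
  · rw [costX_zero, mul_zero] at hx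
    linarith
  have hVl : S.costX x ≤ S.mpcValue N θ x :=
    hV ▸ S.costX_rollout_le_mpcCost hmx hmu hQm hRm (Nat.zero_le N) θ x u
  have hl : 0 < S.costX x := lt_of_lt_of_le (by positivity) (hQm x)
  set b : ℕ → ℝ := fun i => z * (‖ξ i‖ + ‖u i‖)
  have hb : ∀ k ≤ N, ∑ i ∈ range k, b i ^ 2 ≤ z ^ 2 * c.M * S.mpcValue N θ x := by
    intro k hk
    have h1 : ∑ i ∈ range N, S.cost (ξ i) (u i) ≤ S.mpcValue N θ x := by
      rw [hV, mpcCost, S.costStar_eq hmu hRm]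
      exact le_add_of_nonneg_right (S.costX_nonneg hmx hQm _)
    calc ∑ i ∈ range k, b i ^ 2 ≤ ∑ i ∈ range N, b i ^ 2 :=
          sum_le_sum_of_subset_of_nonneg (range_mono hk) fun _ _ _ => sq_nonneg _
      _ ≤ ∑ i ∈ range N, z ^ 2 * c.M * S.cost (ξ i) (u i) := sum_le_sum fun i _ => by
          have := S.sq_norm_add_norm_le c hmx hmu hQm hRm (ξ i) (u i)
          simp only [b]
          rw [mul_pow, mul_assoc]
          gcongr
      _ ≤ _ := by rw [← mul_sum]; gcongr
  have he : ∀ k ≤ N, ‖η k - ξ k‖ ^ 2 ≤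
      (∑ i ∈ range k, c.Lfx ^ (2 * i)) * (z ^ 2 * c.M * S.mpcValue N θ x) := by
    intro k hk
    have h1 := le_pow_mul_add_sum hLfx0 (a := fun k => ‖η k - ξ k‖) (b := b) (k := k)
      fun i _ => by
        have e : ‖η (i + 1) - ξ (i + 1)‖ = ‖Matrix.toEuclideanLin (S.A θhat) (ξ i - η i) +
            Matrix.toEuclideanLin (S.A θ - S.A θhat) (ξ i) +
            Matrix.toEuclideanLin (S.B θ - S.B θhat) (u i)‖ := by
          rw [norm_sub_rev, hξ, hη, rollout_succ, rollout_succ, step_sub_step]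
        simp only [e]
        have h2 := hLfx (ξ i - η i)
        rw [norm_sub_rev (ξ i)] at h2
        have h3 := hΔA (ξ i)
        have h4 := hΔB (u i)
        refine norm_add₃_le.trans ?_
        simp only [b]
        linarith
    have h0 : η 0 - ξ 0 = 0 := sub_self x
    simp only [h0, norm_zero, mul_zero, zero_add] at h1
    calc ‖η k - ξ k‖ ^ 2 ≤ (∑ i ∈ range k, c.Lfx ^ (k - 1 - i) * b i) ^ 2 := by gcongr
      _ ≤ (∑ i ∈ range k, (c.Lfx ^ (k - 1 - i)) ^ 2) * ∑ i ∈ range k, b i ^ 2 :=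
          sum_mul_sq_le_sq_mul_sq _ _ _
      _ = (∑ i ∈ range k, c.Lfx ^ (2 * i)) * ∑ i ∈ range k, b i ^ 2 := by
          rw [← sum_range_reflect (fun i => c.Lfx ^ (2 * i))]
          congr 1
          exact sum_congr rfl fun i _ => by rw [← pow_mul, mul_comm]
      _ ≤ _ := mul_le_mul_of_nonneg_left (hb k hk) (by positivity)
  -- The sums start at time 1 because both rollouts start at x. Hence Cauchy–Schwarz sees only
  -- V_N(x;θ) - ℓ_x(x), as the scalar lemma requires.
  set E := ∑ k ∈ range N, ‖η (k + 1) - ξ (k + 1)‖ ^ 2 with hE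
  set F := ∑ k ∈ range N, ‖ξ (k + 1)‖ * ‖η (k + 1) - ξ (k + 1)‖ with hF
  have hE' : E ≤ c.P N * (z ^ 2 * c.M * S.mpcValue N θ x) := by
    calc E ≤ ∑ k ∈ range N, (∑ i ∈ range (k + 1), c.Lfx ^ (2 * i)) *
          (z ^ 2 * c.M * S.mpcValue N θ x) :=
          sum_le_sum fun k hk => he (k + 1) (by rw [mem_range] at hk; omega)
      _ ≤ _ := by rw [← sum_mul]; gcongr
  have hVsplit : S.mpcValue N θ x =
      ∑ k ∈ range N, S.costX (ξ (k + 1)) + S.costX x + ∑ k ∈ range N, S.costU (u k) := by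
    rw [hV, S.mpcCost_eq hmu hRm, sum_range_succ']; rfl
  have hU0 : 0 ≤ ∑ k ∈ range N, S.costU (u k) := sum_nonneg fun _ _ => S.costU_nonneg hmu hRm _
  have hF' : F ^ 2 ≤ 2 / c.mx * (S.mpcValue N θ x - S.costX x) * E := by
    refine (sum_norm_mul_sq_le hmx hQm (range N) (fun k => ξ (k + 1)) _).trans ?_
    have hE0 : 0 ≤ E := sum_nonneg fun _ _ => sq_nonneg _
    refine mul_le_mul_of_nonneg_right (mul_le_mul_of_nonneg_left ?_ (by positivity)) hE0
    linarith
  have hW : S.mpcValue N θhat x ≤ S.mpcValue N θ x + c.Lx * F + c.Lx / 2 * E := by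
    refine (S.mpcValue_le hmx hmu hQm hRm N θhat x hua).trans ?_
    have h1 : ∑ k ∈ range N, S.costX (η (k + 1)) ≤
        ∑ k ∈ range N, S.costX (ξ (k + 1)) + c.Lx * F + c.Lx / 2 * E := by
      rw [hE, hF, mul_sum, mul_sum, ← sum_add_distrib, ← sum_add_distrib]
      refine sum_le_sum fun k _ => ?_
      have := S.costX_add_le hQ hLx.le hQL (x := ξ (k + 1)) (le_refl ‖η (k + 1) - ξ (k + 1)‖)
      rwa [add_sub_cancel] at this
    have h2 : S.mpcCost N θhat x u =
        ∑ k ∈ range N, S.costX (η (k + 1)) + S.costX x + ∑ k ∈ range N, S.costU (u k) := by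
      rw [S.mpcCost_eq hmu hRm, sum_range_succ']; rfl
    linarith
  have hfin := le_add_sqrt_mul_of_perturbation (h := √(2 * c.M * c.P N / c.mx) * z) hmx
    (S.mx_le_Lx hQm hQL hx0) hγ (by positivity) hl hVl hle hx hW hF' (hE'.trans_eq (by
      rw [mul_pow, Real.sq_sqrt (by positivity)]; field_simp))
  refine hfin.trans_eq ?_
  rw [mul_div_right_comm (2 * c.M * c.P N) c.γbar, Real.sqrt_mul (by positivity)]
  ring

/-- The terminal cost ℓ_x is at most the stage cost at time N, so J_N is at most the first N+1 terms
of the infinite sum. -/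
theorem mpcValue_le_oracleCost {a b : ℝ} (ha : 0 < a) (hb : 0 < b)
    (hQm : ∀ x, a / 2 * ‖x‖ ^ 2 ≤ S.costX x) (hRm : ∀ u, b / 2 * ‖u‖ ^ 2 ≤ S.costU u)
    (N : ℕ) (θ x) : ENNReal.ofReal (S.mpcValue N θ x) ≤ S.oracleCost θ x := by
  have hcost : ∀ z w, 0 ≤ S.cost z w := fun z w =>
    add_nonneg (S.costX_nonneg ha hQm z) (S.costU_nonneg hb hRm w)
  refine le_iInf₂ fun u hu => ?_
  calc ENNReal.ofReal (S.mpcValue N θ x)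
      ≤ ENNReal.ofReal (∑ k ∈ range (N + 1), S.cost (S.rollout θ x u k) (u k)) := by
        refine ENNReal.ofReal_le_ofReal ((S.mpcValue_le ha hb hQm hRm N θ x hu).trans ?_)
        rw [sum_range_succ, mpcCost, S.costStar_eq hb hRm, cost]
        have := S.costU_nonneg hb hRm (u N)
        linarith
    _ = ∑ k ∈ range (N + 1), ENNReal.ofReal (S.cost (S.rollout θ x u k) (u k)) :=
        ENNReal.ofReal_sum_of_nonneg fun _ _ => hcost _ _
    _ ≤ _ := ENNReal.sum_le_tsum _

end LQSystem

/-! ### Monotonicity of the bounds in the mismatch -/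

namespace LQConstants

variable (c : LQConstants)

theorem alphaStar_nonneg (hmx : 0 < c.mx) (hLx : 0 < c.Lx) (hmu : 0 < c.mu) (hLu : 0 < c.Lu)
    (hLΔ : 0 ≤ c.LΔ) {C ρ : ℝ} (hρ0 : 0 < ρ) (hρ1 : ρ < 1) (N : ℕ) {δ : ℝ}
    (hδ : 0 ≤ δ) : 0 ≤ c.alphaStar C ρ N δ := by
  have hρ2 : 0 < 1 - ρ ^ 2 := sub_pos.2 (pow_lt_one₀ hρ0.le hρ1 two_ne_zero)
  unfold alphaStar alpha2 alpha1 M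
  positivity

theorem alphaStar_mono (hmx : 0 < c.mx) (hLx : 0 < c.Lx) (hmu : 0 < c.mu) (hLu : 0 < c.Lu)
    (hLΔ : 0 ≤ c.LΔ) {C ρ : ℝ} (hρ0 : 0 < ρ) (hρ1 : ρ < 1) (N : ℕ) {δ ε : ℝ}
    (hδ : 0 ≤ δ) (hδε : δ ≤ ε) : c.alphaStar C ρ N δ ≤ c.alphaStar C ρ N ε := by
  have hρ2 : 0 < 1 - ρ ^ 2 := sub_pos.2 (pow_lt_one₀ hρ0.le hρ1 two_ne_zero)
  have h2 : 0 ≤ c.alpha2 C ρ N := by unfold alpha2 M; positivity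
  have h1 : 0 ≤ c.alpha1 C ρ N := Real.sqrt_nonneg _
  unfold alphaStar
  gcongr

/-- The left side is all that the model comparison costs; the other terms of β⋆ are nonnegative. -/
theorem le_betaStar (hmx : 0 < c.mx) (hLx : 0 < c.Lx) (hmu : 0 < c.mu) (hLu : 0 < c.Lu)
    (hLfx : 0 ≤ c.Lfx) (hLΔ : 0 ≤ c.LΔ) (hγ : 0 ≤ c.γbar) {ω : ℝ} (hω : 0 ≤ ω) (N : ℕ)
    {δ ε : ℝ} (hδ : 0 ≤ δ) (hδε : δ ≤ ε) :
    √(2 * c.M * c.P N * c.γbar / c.mx) * c.Lx * (c.LΔ * δ) ≤ c.betaStar ω N ε := by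
  have hε : 0 ≤ ε := hδ.trans hδε
  have hM : 0 < c.M := by unfold M; positivity
  have hP : 0 ≤ c.P N := by
    unfold P
    exact add_nonneg (sum_nonneg fun _ _ => by positivity)
      (sum_nonneg fun _ _ => sum_nonneg fun _ _ => by positivity)
  have h1 : 0 ≤ c.beta2 ω N * ε ^ 2 := by unfold beta2; positivity
  have h2 : 0 ≤ 2 * ω * (c.Lx / c.mx * √(c.P N) + c.Lu / √(c.mx * c.mu) * √N) * ε := by
    positivity
  have h3 : √(2 * c.M * c.P N * c.γbar / c.mx) * c.Lx * (c.LΔ * δ) ≤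
      √(2 * c.M * c.P N * c.γbar / c.mx) * c.Lx * (c.LΔ * ε) := by gcongr
  rw [betaStar, beta1]
  linarith

theorem ratio_zero (hγ : 0 ≤ c.γbar) (C ρ ω : ℝ) (N : ℕ) :
    c.ratio C ρ ω N 0 = 1 / (1 - c.eps N) := by
  simp [ratio, alphaStar, betaStar, hγ]

end LQConstants

/-! ### Closed-loop cost and invariance of sublevel sets -/

namespace LQSystem

variable {n m p r : ℕ} (S : LQSystem n m p r)

theorem continuous_mpcValue {a b : ℝ} (ha : 0 < a) (hb : 0 < b)
    (hQm : ∀ x, a / 2 * ‖x‖ ^ 2 ≤ S.costX x) (hRm : ∀ u, b / 2 * ‖u‖ ^ 2 ≤ S.costU u)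
    {N : ℕ} {θ} {C ρ : ℝ} (hS : S.StateSensitivity N θ Set.univ C ρ) :
    Continuous (S.mpcValue N θ) := by
  have h : S.mpcValue N θ = fun x => S.mpcCost N θ x (S.mpcInput N θ x) :=
    funext fun x => S.mpcValue_eq ha hb hQm hRm N θ x
  rw [h]
  refine S.continuous_mpcCost hb hRm θ continuous_id fun k hk => ?_
  refine (LipschitzWith.of_dist_le' (K := C * ρ ^ k) fun x y => ?_).continuous
  rw [dist_eq_norm, dist_eq_norm]
  exact hS x trivial y trivial k hk

/-- The decrease telescopes, and V ≥ 0 discards the final value. -/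
theorem closedLoopCost_le_of_decrease {N : ℕ} {θhat θ x} {a : ℝ} {V : EuclideanSpace ℝ (Fin n) → ℝ}
    (ha : 0 < a) (hV : ∀ y, 0 ≤ V y) (hcost : ∀ y u, 0 ≤ S.cost y u)
    (h : ∀ t, V (S.closedLoop N θhat θ x (t + 1)) ≤ V (S.closedLoop N θhat θ x t) -
      a * S.cost (S.closedLoop N θhat θ x t) (S.policy N θhat (S.closedLoop N θhat θ x t))) :
    S.closedLoopCost N θhat θ x ≤ ENNReal.ofReal (V x / a) := by
  have hsum : ∀ T, a * ∑ t ∈ range T, S.cost (S.closedLoop N θhat θ x t)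
      (S.policy N θhat (S.closedLoop N θhat θ x t)) + V (S.closedLoop N θhat θ x T) ≤ V x := by
    intro T
    induction T with
    | zero => simp [closedLoop]
    | succ T ih => rw [sum_range_succ]; linarith [h T]
  refine ENNReal.tsum_le_of_sum_range_le fun T => ?_
  rw [← ENNReal.ofReal_sum_of_nonneg fun _ _ => hcost _ _]
  refine ENNReal.ofReal_le_ofReal ((le_div_iff₀ ha).2 ?_)
  linarith [hsum T, hV (S.closedLoop N θhat θ x T)]

/-- If the value function decreases towards every point in `X` of the segment from the nominal to
the true successor, then sublevel sets of the value function contained in `X` are invariant. -/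
theorem staysIn_of_sublevel_subset {a b : ℝ} (ha : 0 < a) (hb : 0 < b)
    (hQm : ∀ x, a / 2 * ‖x‖ ^ 2 ≤ S.costX x) (hRm : ∀ u, b / 2 * ‖u‖ ^ 2 ≤ S.costU u)
    {N : ℕ} {θhat θ : EuclideanSpace ℝ (Fin p)} {X : Set (EuclideanSpace ℝ (Fin n))} {e η : ℝ}
    (hcont : Continuous (S.mpcValue N θhat)) (he : 0 ≤ e) (hη : 0 < η)
    (hnom : ∀ x, (∀ k ≤ N, S.rollout θhat x (S.mpcInput N θhat x) k ∈ X) →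
      S.mpcValue N θhat (S.step θhat x (S.policy N θhat x)) ≤
        S.mpcValue N θhat x - e * S.cost x (S.policy N θhat x))
    (hdec : ∀ x y, (∀ k ≤ N, S.rollout θhat x (S.mpcInput N θhat x) k ∈ X) → y ∈ X →
      ‖y - S.step θhat x (S.policy N θhat x)‖ ≤
        ‖S.step θ x (S.policy N θhat x) - S.step θhat x (S.policy N θhat x)‖ →
      S.mpcValue N θhat y ≤ S.mpcValue N θhat x - η * S.cost x (S.policy N θhat x))
    {x} (hx : {y | S.costX y ≤ S.mpcValue N θhat x} ⊆ X) : S.StaysIn N θhat θ X x := by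
  have hX : ∀ y, S.mpcValue N θhat y ≤ S.mpcValue N θhat x → ∀ k ≤ N,
      S.rollout θhat y (S.mpcInput N θhat y) k ∈ X := fun y hy k hk => hx <| by
    refine (S.costX_rollout_le_mpcCost ha hb hQm hRm hk θhat y _).trans ?_
    rwa [← S.mpcValue_eq ha hb hQm hRm]
  have hcost : ∀ y u, 0 ≤ S.cost y u := fun y u =>
    add_nonneg (S.costX_nonneg ha hQm y) (S.costU_nonneg hb hRm u)
  suffices h : ∀ t, S.mpcValue N θhat (S.closedLoop N θhat θ x t) ≤ S.mpcValue N θhat x from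
    fun t => hX _ (h t)
  intro t
  induction t with
  | zero => exact le_rfl
  | succ t ih =>
    set y := S.closedLoop N θhat θ x t with hy
    set u := S.policy N θhat y with hu
    have hsucc : S.closedLoop N θhat θ x (t + 1) = S.step θ y u := rfl
    rw [hsucc]
    -- `hdec` cannot be applied to the true successor y₁ directly, as y₁ ∈ X is not yet known.
    by_contra! hlt
    set y₀ := S.step θhat y u with hy₀
    set y₁ := S.step θ y u with hy₁
    have h0 : S.mpcValue N θhat y₀ ≤ S.mpcValue N θhat x := by
      have h1 := hnom y (hX y ih)
      have h2 := mul_nonneg he (hcost y u)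
      linarith
    set g : ℝ → ℝ := fun s => S.mpcValue N θhat (y₀ + s • (y₁ - y₀)) with hg
    have hgc : Continuous g := hcont.comp (by fun_prop)
    have hg0 : g 0 = S.mpcValue N θhat y₀ := by simp [hg]
    have hg1 : g 1 = S.mpcValue N θhat y₁ := by simp [hg]
    -- A point of the segment from y₀ to y₁ exactly on the level V_N(x); it does lie in X. The
    -- decrease there leaves no room for a positive stage cost.
    obtain ⟨s, ⟨hs0, hs1⟩, hs⟩ := intermediate_value_Icc zero_le_one hgc.continuousOn
      (show S.mpcValue N θhat x ∈ Set.Icc (g 0) (g 1) from ⟨hg0 ▸ h0, hg1 ▸ hlt.le⟩)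
    have hmem : y₀ + s • (y₁ - y₀) ∈ X := hX _ hs.le 0 (Nat.zero_le N)
    have h3 := hdec y _ (hX y ih) hmem (by
      rw [add_sub_cancel_left, norm_smul, Real.norm_of_nonneg hs0]
      exact mul_le_of_le_one_left (norm_nonneg _) hs1)
    have h4 : S.mpcValue N θhat x ≤ S.mpcValue N θhat y - η * S.cost y u := hs.symm.trans_le h3
    have h5 : S.cost y u = 0 := by
      refine le_antisymm ?_ (hcost y u)
      by_contra! h
      have := mul_pos hη h
      linarith
    have h6 : S.costX y = 0 ∧ S.costU u = 0 := by
      have := S.costX_nonneg ha hQm y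
      have := S.costU_nonneg hb hRm u
      rw [cost] at h5
      constructor <;> linarith
    have hy0 : y = 0 := by
      by_contra h
      have h7 := hQm y
      have : 0 < a / 2 * ‖y‖ ^ 2 := by positivity
      linarith
    have hu0 : u = 0 := by
      by_contra h
      have h7 := hRm u
      have : 0 < b / 2 * ‖u‖ ^ 2 := by positivity
      linarith
    -- Zero stage cost means that the system rests at the origin, where V_N vanishes: this
    -- contradicts `hlt`.
    have h7 : y₁ = 0 := by simp [hy₁, step, hy0, hu0]
    have h8 := S.mpcValue_le ha hb hQm hRm N θhat 0 S.zero_mem_admissible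
    rw [S.mpcCost_zero_zero hb hRm, ← h7] at h8
    have h9 := S.mpcCost_nonneg ha hb hQm hRm N θhat x (S.mpcInput N θhat x)
    rw [← S.mpcValue_eq ha hb hQm hRm] at h9
    linarith

end LQSystem

/-! ### Assembly of the competitive ratio -/

theorem mainTheorem3 {n m p r : ℕ} (S : LQSystem n m p r) (c : LQConstants)
    (hQ : S.Q.PosDef) (hR : S.R.PosDef)
    -- the uncertainty set: a bounded set of parameters around the nominal one
    (θhat : EuclideanSpace ℝ (Fin p)) (Θ : Set (EuclideanSpace ℝ (Fin p))) (εθ : ℝ)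
    (hΘ : ∀ θ ∈ Θ, ‖θ - θhat‖ ≤ εθ)
    -- strong convexity and smoothness of the costs (the gradient of `xᵀ Q x` is `2 Q x`)
    (hmx : 0 < c.mx) (hLx : 0 < c.Lx) (hmu : 0 < c.mu) (hLu : 0 < c.Lu)
    (hQm : ∀ x, c.mx / 2 * ‖x‖ ^ 2 ≤ S.costX x)
    (hQL : ∀ x, ‖(2 : ℝ) • Matrix.toEuclideanLin S.Q x‖ ≤ c.Lx * ‖x‖)
    (hRm : ∀ u, c.mu / 2 * ‖u‖ ^ 2 ≤ S.costU u)
    (hRL : ∀ u, ‖(2 : ℝ) • Matrix.toEuclideanLin S.R u‖ ≤ c.Lu * ‖u‖)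
    -- Lipschitz constants of the nominal dynamics
    (hLfx0 : 0 ≤ c.Lfx) (hLfu0 : 0 ≤ c.Lfu)
    (hLfx : ∀ x, ‖Matrix.toEuclideanLin (S.A θhat) x‖ ≤ c.Lfx * ‖x‖)
    (hLfu : ∀ u, ‖Matrix.toEuclideanLin (S.B θhat) u‖ ≤ c.Lfu * ‖u‖)
    -- `A` and `B` are Lipschitz at the nominal parameter
    (hLΔ0 : 0 ≤ c.LΔ)
    (hΔA : ∀ θ ∈ Θ, ∀ x, ‖Matrix.toEuclideanLin (S.A θ - S.A θhat) x‖
      ≤ c.LΔ * ‖θ - θhat‖ * ‖x‖)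
    (hΔB : ∀ θ ∈ Θ, ∀ u, ‖Matrix.toEuclideanLin (S.B θ - S.B θhat) u‖
      ≤ c.LΔ * ‖θ - θhat‖ * ‖u‖)
    -- relaxed control Lyapunov function and cost controllability, on `X`, for the nominal model
    (X : Set (EuclideanSpace ℝ (Fin n))) (hκ : 0 ≤ c.κ)
    (hclf : ∀ x ∈ X, ∃ u ∈ S.inputSet,
      S.costX (S.step θhat x u) + S.cost x u ≤ (1 + c.κ) * S.costX x)
    (hγ : ∀ i, 1 ≤ i → 0 < c.γ i ∧ c.γ i ≤ c.γbar)
    (hctrl : ∀ x ∈ X, ∀ i, 1 ≤ i → S.mpcValue i θhat x ≤ (1 + c.γ i) * S.costStar x)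
    (N : ℕ) (hN : 1 ≤ N) :
    -- the MPC problem has a solution, unique in its `N` inputs
    (∀ θ x, ∃ u, S.IsMPCSolution N θ x u ∧
      ∀ v, S.IsMPCSolution N θ x v → ∀ k < N, v k = u k) ∧
    -- sensitivity constants exist
    (∃ C ρ ω : ℝ, 0 < C ∧ 0 < ρ ∧ ρ < 1 ∧ 0 ≤ ω ∧
      S.StateSensitivity N θhat Set.univ C ρ ∧ S.ParamSensitivity N θhat Θ Set.univ ω) ∧
    -- and for all sensitivity constants the competitive-ratio bound holds
    (∀ C ρ ω : ℝ, 0 < C → 0 < ρ → ρ < 1 → 0 ≤ ω →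
      S.StateSensitivity N θhat X C ρ → S.ParamSensitivity N θhat Θ X ω →
      -- consistency: without mismatch the ratio is the nominal one
      c.ratio C ρ ω N 0 = 1 / (1 - c.eps N) ∧
      ∀ θ ∈ Θ, ∀ ε : ℝ, ‖θ - θhat‖ ≤ ε → c.alphaStar C ρ N ε + c.eps N < 1 →
        ∀ x : EuclideanSpace ℝ (Fin n),
          ({y | S.costX y ≤ S.mpcValue N θhat x} ⊆ X → S.StaysIn N θhat θ X x) ∧
          (S.StaysIn N θhat θ X x →
            S.closedLoopCost N θhat θ x < ∞ ∧
            S.closedLoopCost N θhat θ x ≤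
              ENNReal.ofReal (c.ratio C ρ ω N ε) * S.oracleCost θ x)) := by
  have hQh := hQ.isHermitian
  have hRh := hR.isHermitian
  have hγ0 : ∀ i, 1 ≤ i → 0 < c.γ i := fun i hi => (hγ i hi).1
  have hγbar : 0 ≤ c.γbar := (hγ 1 le_rfl).1.le.trans (hγ 1 le_rfl).2
  have hε0 := c.eps_nonneg hκ hγ0 hN
  have hcost : ∀ x u, 0 ≤ S.cost x u := fun x u =>
    add_nonneg (S.costX_nonneg hmx hQm x) (S.costU_nonneg hmu hRm u)
  have hexists : ∃ C ρ ω : ℝ, 0 < C ∧ 0 < ρ ∧ ρ < 1 ∧ 0 ≤ ω ∧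
      S.StateSensitivity N θhat Set.univ C ρ ∧ S.ParamSensitivity N θhat Θ Set.univ ω := by
    refine S.exists_sensitivity_constants (L := 1 + c.Lfx + c.Lfu) hmx hmu hQm hRm hQh hRh hQL hLx
      θhat Θ hΘ (by linarith) hLΔ0 (fun x => (hLfx x).trans ?_) (fun u => (hLfu u).trans ?_)
      hΔA hΔB N
    · gcongr; linarith
    · gcongr; linarith
  refine ⟨fun θ x => ?_, hexists, fun C ρ ω hC hρ0 hρ1 hω hSS _ =>
    ⟨c.ratio_zero hγbar C ρ ω N, fun θ hθ ε hε hα x => ?_⟩⟩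
  · obtain ⟨u, hu⟩ := S.exists_isMPCSolution hmx hmu hQm hRm N θ x
    exact ⟨u, hu, fun v hv k hk => hu.unique hmx hmu hQm hRm hQh hRh hv hk⟩
  set δ := ‖θ - θhat‖
  have hδ : 0 ≤ δ := norm_nonneg _
  have hα0 := c.alphaStar_nonneg hmx hLx hmu hLu hLΔ0 (C := C) hρ0 hρ1 N (hδ.trans hε)
  set η := 1 - (c.alphaStar C ρ N ε + c.eps N) with hη
  have hη0 : 0 < η := sub_pos.2 hα
  have hctrl' : ∀ z ∈ X, S.mpcValue N θhat z ≤ (1 + c.γbar) * S.costX z := by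
    intro z hz
    have h := hctrl z hz N hN
    rw [S.costStar_eq hmu hRm] at h
    refine h.trans (mul_le_mul_of_nonneg_right ?_ (S.costX_nonneg hmx hQm z))
    linarith [(hγ N hN).2]
  have hnom : ∀ x, (∀ k ≤ N, S.rollout θhat x (S.mpcInput N θhat x) k ∈ X) →
      S.mpcValue N θhat (S.step θhat x (S.policy N θhat x)) ≤
        S.mpcValue N θhat x - (1 - c.eps N) * S.cost x (S.policy N θhat x) := fun x hX =>
    S.mpcValue_step_le c hmx hmu hQm hRm θhat X hκ hclf hγ0 hctrl hN hX
  -- Stated for all y ∈ X as close to the nominal successor as the true one: the true successor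
  -- gives the telescoping decrease, the other points serve the invariance argument.
  have hdec : ∀ x y, (∀ k ≤ N, S.rollout θhat x (S.mpcInput N θhat x) k ∈ X) → y ∈ X →
      ‖y - S.step θhat x (S.policy N θhat x)‖ ≤
        ‖S.step θ x (S.policy N θhat x) - S.step θhat x (S.policy N θhat x)‖ →
      S.mpcValue N θhat y ≤ S.mpcValue N θhat x - η * S.cost x (S.policy N θhat x) := by
    intro x y hX hy hxy
    have h1 := hnom x hX
    set u := S.policy N θhat x
    have hl := hcost x u
    have h2 : S.mpcValue N θhat (S.step θhat x u) ≤ (c.γbar + c.eps N) * S.cost x u := by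
      have h3 := hctrl' x (hX 0 (Nat.zero_le N))
      have h4 : (1 + c.γbar) * S.costX x ≤ (1 + c.γbar) * S.cost x u := by
        refine mul_le_mul_of_nonneg_left ?_ (by linarith)
        exact le_add_of_nonneg_right (S.costU_nonneg hmu hRm u)
      linarith
    have h5 : ‖y - S.step θhat x u‖ ^ 2 ≤ c.LΔ ^ 2 * δ ^ 2 * (c.M * S.cost x u) := by
      have h6 : ‖S.step θ x u - S.step θhat x u‖ ≤ c.LΔ * δ * (‖x‖ + ‖u‖) := by
        rw [S.step_sub_step, sub_self, map_zero, zero_add]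
        refine (norm_add_le _ _).trans ?_
        linarith [hΔA θ hθ x, hΔB θ hθ u]
      calc _ ≤ (c.LΔ * δ * (‖x‖ + ‖u‖)) ^ 2 := by
            gcongr
            exact hxy.trans h6
        _ = c.LΔ ^ 2 * δ ^ 2 * (‖x‖ + ‖u‖) ^ 2 := by ring
        _ ≤ _ := by
            gcongr
            exact S.sq_norm_add_norm_le c hmx hmu hQm hRm x u
    have h7 := S.mpcValue_le_add_alphaStar c hQh hRh hmx hLx hmu hLu hQm hQL hRm hRL hLfx0 hLfu0
      hLfx hLfu hLΔ0 (by linarith) hC hρ0 hρ1 hSS (hX 1 hN) hy hδ hl h5 h2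
    have h8 := mul_le_mul_of_nonneg_right
      (c.alphaStar_mono hmx hLx hmu hLu hLΔ0 (C := C) hρ0 hρ1 N hδ hε) hl
    change S.mpcValue N θhat y ≤ S.mpcValue N θhat (S.step θhat x u) + _ at h7
    rw [hη]
    linarith
  have hV0 : ∀ θ y, 0 ≤ S.mpcValue N θ y := fun θ y => by
    rw [S.mpcValue_eq hmx hmu hQm hRm]
    exact S.mpcCost_nonneg hmx hmu hQm hRm N θ y _
  refine ⟨fun hx => ?_, fun hx => ?_⟩
  -- Continuity of V_N is needed on segments that may leave X, so constants valid on the whole space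
  -- are taken here.
  · obtain ⟨C', ρ', _, _, _, _, _, hS', _⟩ := hexists
    exact S.staysIn_of_sublevel_subset hmx hmu hQm hRm
      (S.continuous_mpcValue hmx hmu hQm hRm hS') (by linarith) hη0 hnom hdec hx
  · have h1 : S.closedLoopCost N θhat θ x ≤ ENNReal.ofReal (S.mpcValue N θhat x / η) :=
      S.closedLoopCost_le_of_decrease hη0 (hV0 θhat) hcost fun t =>
        hdec _ _ (hx t) (hx (t + 1) 0 (Nat.zero_le N)) le_rfl
    refine ⟨h1.trans_lt ENNReal.ofReal_lt_top, h1.trans ?_⟩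
    have hxX : x ∈ X := hx 0 0 (Nat.zero_le N)
    have hβ := c.le_betaStar hmx hLx hmu hLu hLfx0 hLΔ0 hγbar hω N hδ hε
    have hβ0 : 0 ≤ c.betaStar ω N ε := le_trans (by positivity) hβ
    have hVV : S.mpcValue N θhat x ≤
        (1 + min c.γbar (c.betaStar ω N ε)) * S.mpcValue N θ x := by
      rcases min_choice c.γbar (c.betaStar ω N ε) with h | h <;> rw [h]
      · refine (hctrl' x hxX).trans (mul_le_mul_of_nonneg_left ?_ (by linarith))
        rw [S.mpcValue_eq hmx hmu hQm hRm]
        exact S.costX_rollout_le_mpcCost hmx hmu hQm hRm (Nat.zero_le N) θ x _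
      · have h2 := S.mpcValue_le_mpcValue_add c hQh hmx hLx hmu hQm hQL hRm hLfx0 hLfx
          (mul_nonneg hLΔ0 hδ) (hΔA θ hθ) (hΔB θ hθ) hγbar (hctrl' x hxX)
        have h3 := mul_le_mul_of_nonneg_right hβ (hV0 θ x)
        linarith
    have hratio : 0 ≤ c.ratio C ρ ω N ε :=
      div_nonneg (add_nonneg zero_le_one (le_min hγbar hβ0)) hη0.le
    calc ENNReal.ofReal (S.mpcValue N θhat x / η)
        ≤ ENNReal.ofReal (c.ratio C ρ ω N ε * S.mpcValue N θ x) := by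
          refine ENNReal.ofReal_le_ofReal ?_
          rw [LQConstants.ratio, ← hη, div_mul_eq_mul_div]
          gcongr
      _ = ENNReal.ofReal (c.ratio C ρ ω N ε) * ENNReal.ofReal (S.mpcValue N θ x) :=
          ENNReal.ofReal_mul hratio
      _ ≤ _ := by
          gcongr
          exact S.mpcValue_le_oracleCost hmx hmu hQm hRm N θ x
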